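/- \textbf{Theorem (exponential metric increasing property).} Let $\mathcal M$ be a von Neumann algebra with a faithful normal tracial state $\tau$ (so $\mathcal M$ is finite), and let $1\le p\le\infty$. Write $\|x\|_p=\tau(|x|^p)^{1/p}$ for $p<\infty$ and $\|x\|_\infty=\|x\|$ for the uniform norm; let $L^p$ be the completion of $\mathcal M$ with respect to $\|\cdot\|_p$, $\mathcal B(L^p)$ the algebra of bounded linear operators on it, $\mathcal M_h$ the set of self-adjoint elements of $\mathcal M$, and $\mathcal P\subset\mathcal M_h$ the set of positive invertible elements. A curve defined on $[0,1]$ is piecewise smooth if it is continuous and $[0,1]$ can be subdivided into finitely many closed intervals on each of which the curve is $C^1$ in the uniform norm with nowhere vanishing derivative. For $a\in\mathcal P$ and $x\in\mathcal M_h$ put $\|x\|_{a,p}=\|a^{-1/2}xa^{-1/2}\|_p$. For piecewise smooth curves $\Gamma:[0,1]\to\mathcal M_h$ and $\gamma:[0,1]\to\mathcal P$ put $$\ell_p(\Gamma)=\int_0^1\|\dot\Gamma(t)\|_p\,dt,\qquad \ell_{\mathcal P_p}(\gamma)=\int_0^1\|\dot\gamma(t)\|_{\gamma(t),p}\,dt,$$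 and for $a,b\in\mathcal P$ let $d_p(a,b)$ be the infimum of $\ell_{\mathcal P_p}(\gamma)$ over all piecewise smooth curves $\gamma:[0,1]\to\mathcal P$ with $\gamma(0)=a$ and $\gamma(1)=b$. Let $F(z)=z^{-1}\sinh z=\sum_{n\ge0}\frac{z^{2n}}{(2n+1)!}$ and $\operatorname{ad}w(y)=wy-yw$. Then: (1) For every $w\in\mathcal M_h$ the map $\operatorname{ad}w$ extends to an operator $\widetilde{\operatorname{ad}}\,w\in\mathcal B(L^p)$, and $F(\widetilde{\operatorname{ad}}\,w)\in\mathcal B(L^p)$ extends $F(\operatorname{ad}w)$, is invertible in $\mathcal B(L^p)$, and is expansive: $\|F(\widetilde{\operatorname{ad}}\,w)z\|_p\ge\|z\|_p$ for all $z\in L^p$. (2) If $\gamma=e^{\Gamma}:[0,1]\to\mathcal P$ is a piecewise smooth curve, where $\Gamma$ takes values in $\mathcal M_h$, then $\Gamma$ is piecewise smooth and $\ell_p(\Gamma)\le\ell_{\mathcal P_p}(\gamma)$. (3) For all $v,w\in\mathcal M_h$, $d_p(e^w,e^v)\ge\|w-v\|_p$. -/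

import Mathlib

open Set Filter Topology MeasureTheory
open scoped ENNReal ComplexOrder

/-- A faithful normal tracial state on `M`. Normality: `τ` preserves suprema of bounded increasing
nets of positive elements. -/
structure FaithfulNormalTracialState (M : Type*) [CStarAlgebra M] [PartialOrder M]
    [StarOrderedRing M] extends M →ₚ[ℂ] ℂ where
  map_one' : toFun 1 = 1
  tracial' : ∀ x y, toFun (x * y) = toFun (y * x)
  faithful' : ∀ x, toFun (star x * x) = 0 → x = 0
  normal' : ∀ (S : Set M) (a : M), S.Nonempty → DirectedOn (· ≤ ·) S → (∀ x ∈ S, 0 ≤ x) →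
    IsLUB S a → IsLUB ((fun x => (toFun x).re) '' S) (toFun a).re

namespace FaithfulNormalTracialState

/-- The norm `‖x‖_p = τ(|x| ^ p) ^ (1 / p)` for `p < ∞`, and the uniform norm for `p = ∞`. -/
noncomputable def pNorm {M : Type*} [CStarAlgebra M] [PartialOrder M] [StarOrderedRing M]
    (τ : FaithfulNormalTracialState M) (p : ℝ≥0∞) (x : M) : ℝ :=
  if p = ∞ then ‖x‖ else (τ.toPositiveLinearMap (CFC.abs x ^ p.toReal)).re ^ (1 / p.toReal)

/-! ### `‖·‖_p` is a norm

The lemmas of this section prove that `‖·‖_p` is a norm on `M` for `1 ≤ p ≤ ∞`, so that `M` can be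
completed with respect to it. -/

section TraceNorm

set_option linter.unusedSectionVars false

variable {M : Type*} [CStarAlgebra M] [PartialOrder M] [StarOrderedRing M]

/-- The real part of the trace, as a continuous real functional. -/
noncomputable def reTr (τ : FaithfulNormalTracialState M) (x : M) : ℝ :=
  (τ.toPositiveLinearMap x).re

variable (τ : FaithfulNormalTracialState M)

lemma reTr_add (x y : M) : τ.reTr (x + y) = τ.reTr x + τ.reTr y := by simp [reTr]

lemma reTr_sub (x y : M) : τ.reTr (x - y) = τ.reTr x - τ.reTr y := by simp [reTr]

lemma reTr_smul (c : ℝ) (x : M) : τ.reTr (c • x) = c * τ.reTr x := by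
  simp [reTr]

lemma reTr_comm (x y : M) : τ.reTr (x * y) = τ.reTr (y * x) :=
  congrArg Complex.re (τ.tracial' x y)

lemma reTr_nonneg {x : M} (hx : 0 ≤ x) : 0 ≤ τ.reTr x :=
  (Complex.le_def.1 (τ.toPositiveLinearMap.map_nonneg hx)).1

lemma reTr_mono {x y : M} (h : x ≤ y) : τ.reTr x ≤ τ.reTr y := by
  have := τ.reTr_nonneg (sub_nonneg.2 h)
  rw [reTr_sub] at this; linarith

lemma continuous_reTr : Continuous τ.reTr :=
  Complex.continuous_re.comp (map_continuous τ.toPositiveLinearMap)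

lemma reTr_star (x : M) : τ.reTr (star x) = τ.reTr x := by
  have hs : IsSelfAdjoint (Complex.I • (x - star x)) := by
    simp [IsSelfAdjoint, star_smul, star_sub, ← smul_neg]
  have h := (hs.map' τ.toPositiveLinearMap)
  have h2 : (τ.toPositiveLinearMap (Complex.I • (x - star x))).im = 0 :=
    Complex.conj_eq_iff_im.1 h
  rw [map_smul, map_sub, smul_eq_mul, Complex.I_mul_im, Complex.sub_re] at h2
  simp only [reTr]; linarith

lemma reTr_mul_le (P Q : M) :
    τ.reTr (P * Q) ≤ (τ.reTr (P * star P) + τ.reTr (star Q * Q)) / 2 := by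
  have h := τ.reTr_nonneg (star_mul_self_nonneg (star P - Q))
  have e : star (star P - Q) * (star P - Q)
      = P * star P - P * Q - star (P * Q) + star Q * Q := by
    simp only [star_sub, star_star, star_mul]; noncomm_ring
  rw [e, reTr_add, reTr_sub, reTr_sub, reTr_star] at h
  linarith

/-- `(t + ε) ^ s` applied to a nonnegative element. -/
noncomputable def shiftPow (a : M) (ε s : ℝ) : M := cfc (fun t : ℝ => (max t 0 + ε) ^ s) a

lemma cont_shift {ε : ℝ} (hε : 0 < ε) (s : ℝ) : Continuous fun t : ℝ => (max t 0 + ε) ^ s :=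
  Continuous.rpow_const (by fun_prop) fun t => Or.inl (by positivity)

lemma shiftPow_mul (a : M) {ε : ℝ} (hε : 0 < ε) (s r : ℝ) :
    shiftPow a ε s * shiftPow a ε r = shiftPow a ε (s + r) := by
  rw [shiftPow, shiftPow, shiftPow, ← cfc_mul _ _ a (cont_shift hε s).continuousOn
    (cont_shift hε r).continuousOn]
  congr 1; ext t
  rw [Real.rpow_add (by positivity)]

lemma shiftPow_star (a : M) (ε s : ℝ) : star (shiftPow a ε s) = shiftPow a ε s :=
  IsSelfAdjoint.star_eq (cfc_predicate _ a)

lemma shiftPow_zero (a : M) (ha : IsSelfAdjoint a) (ε : ℝ) : shiftPow a ε 0 = 1 := by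
  simp [shiftPow, cfc_const_one ℝ a]

lemma tendsto_cfc_param (F : ℝ → ℝ → ℝ) (hF : Continuous fun z : ℝ × ℝ => F z.1 z.2) (a : M) :
    Continuous fun s => cfc (F s) a := by
  rw [continuous_iff_continuousAt]
  intro s
  refine continuousAt_cfc_fun ?_ (Eventually.of_forall fun s =>
    (hF.comp (by fun_prop : Continuous fun t : ℝ => (s, t))).continuousOn)
  have hc : IsCompact (spectrum ℝ a) := spectrum.isCompact a
  have := isCompact_iff_compactSpace.1 hc
  rw [tendstoUniformlyOn_iff_tendstoUniformly_comp_coe]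
  exact Continuous.tendstoUniformly (fun s (t : spectrum ℝ a) => F s t)
    (hF.comp (by fun_prop : Continuous fun z : ℝ × spectrum ℝ a => (z.1, (z.2 : ℝ)))) s

lemma exists_poly (f : ℝ → ℝ) (hf : Continuous f) (K : ℝ) {δ : ℝ} (hδ : 0 < δ) :
    ∃ q : Polynomial ℝ, ∀ a : M, IsSelfAdjoint a → ‖a‖ ≤ K →
      ‖Polynomial.aeval a q - cfc f a‖ ≤ δ := by
  obtain ⟨q, hq⟩ := exists_polynomial_near_of_continuousOn (-K) K f hf.continuousOn δ hδ
  refine ⟨q, fun a ha haK => ?_⟩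
  rw [← cfc_polynomial q a ha, ← cfc_sub _ _ a (by fun_prop) hf.continuousOn]
  refine norm_cfc_le hδ.le fun x hx => (hq x ?_).le
  obtain h | h := subsingleton_or_nontrivial M
  · rw [spectrum.of_subsingleton] at hx; exact hx.elim
  have := (spectrum.norm_le_norm_of_mem hx).trans haK
  rwa [Real.norm_eq_abs, abs_le] at this

lemma cfc_intertwine (f : ℝ → ℝ) (hf : Continuous f) (x : M) :
    x * cfc f (star x * x) = cfc f (x * star x) * x := by
  have key : ∀ q : Polynomial ℝ, x * Polynomial.aeval (star x * x) q
      = Polynomial.aeval (x * star x) q * x := by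
    intro q
    induction q using Polynomial.induction_on' with
    | add p q hp hq => simp [mul_add, add_mul, hp, hq]
    | monomial n c =>
      have : ∀ n : ℕ, x * (star x * x) ^ n = (x * star x) ^ n * x := by
        intro n
        induction n with
        | zero => simp
        | succ n ih => rw [pow_succ, ← mul_assoc, ih, pow_succ]; noncomm_ring
      simp [Polynomial.aeval_monomial, ← Algebra.smul_def, this]
  refine eq_of_norm_sub_le_zero (le_of_forall_pos_le_add fun δ hδ => ?_)
  obtain ⟨q, hq⟩ := exists_poly (M := M) f hf (‖x‖ * ‖x‖) (δ := δ / (2 * (‖x‖ + 1))) (by positivity)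
  have h1 := hq (star x * x) (.star_mul_self x) (by rw [CStarRing.norm_star_mul_self])
  have h2 := hq (x * star x) (.mul_star_self x) (by rw [CStarRing.norm_self_mul_star])
  have e : x * cfc f (star x * x) - cfc f (x * star x) * x
      = (Polynomial.aeval (x * star x) q - cfc f (x * star x)) * x
        - x * (Polynomial.aeval (star x * x) q - cfc f (star x * x)) := by
    rw [mul_sub, sub_mul, key]; abel
  rw [e, zero_add]
  refine (norm_sub_le _ _).trans ((add_le_add (norm_mul_le _ _) (norm_mul_le _ _)).trans ?_)
  have : δ / (2 * (‖x‖ + 1)) * ‖x‖ ≤ δ / 2 := by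
    rw [div_mul_eq_mul_div, div_le_div_iff₀ (by positivity) (by positivity)]
    nlinarith [norm_nonneg x]
  nlinarith [norm_nonneg x]

lemma reTr_cfc_swap (f : ℝ → ℝ) (hf : Continuous f) (x : M) :
    τ.reTr (cfc f (star x * x)) = τ.reTr (cfc f (x * star x)) := by
  have key : ∀ q : Polynomial ℝ, τ.reTr (Polynomial.aeval (star x * x) q)
      = τ.reTr (Polynomial.aeval (x * star x) q) := by
    intro q
    induction q using Polynomial.induction_on' with
    | add p q hp hq => simp [reTr_add, hp, hq]
    | monomial n c =>
      have : ∀ n : ℕ, τ.reTr ((star x * x) ^ n) = τ.reTr ((x * star x) ^ n) := by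
        intro n
        cases n with
        | zero => simp
        | succ n =>
          have h : ∀ n : ℕ, x * (star x * x) ^ n = (x * star x) ^ n * x := by
            intro n
            induction n with
            | zero => simp
            | succ n ih => rw [pow_succ, ← mul_assoc, ih, pow_succ]; noncomm_ring
          rw [pow_succ', mul_assoc, reTr_comm, h, pow_succ, mul_assoc]
      simp [Polynomial.aeval_monomial, ← Algebra.smul_def, reTr_smul, this]
  have hlim : ∀ n : ℕ, ∃ q : Polynomial ℝ, ∀ a : M, IsSelfAdjoint a → ‖a‖ ≤ ‖x‖ * ‖x‖ →
      ‖Polynomial.aeval a q - cfc f a‖ ≤ 1 / ((n : ℝ) + 1) :=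
    fun n => exists_poly f hf _ (by positivity)
  choose q hq using hlim
  have lim : ∀ a : M, IsSelfAdjoint a → ‖a‖ ≤ ‖x‖ * ‖x‖ →
      Tendsto (fun n => τ.reTr (Polynomial.aeval a (q n))) atTop (𝓝 (τ.reTr (cfc f a))) := by
    intro a ha hb
    refine (τ.continuous_reTr.tendsto _).comp (tendsto_iff_norm_sub_tendsto_zero.2 ?_)
    exact squeeze_zero (fun _ => norm_nonneg _) (fun n => hq n a ha hb)
      tendsto_one_div_add_atTop_nhds_zero_nat
  refine tendsto_nhds_unique (lim _ (.star_mul_self x) (by rw [CStarRing.norm_star_mul_self])) ?_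
  simp only [key]
  exact lim _ (.mul_star_self x) (by rw [CStarRing.norm_self_mul_star])

/-- Midpoint convex continuous functions lie below their chord. -/
lemma le_chord (f : ℝ → ℝ) (hf : Continuous f)
    (hm : ∀ s r, f ((s + r) / 2) ≤ (f s + f r) / 2) {s : ℝ} (h0 : 0 ≤ s) (h1 : s ≤ 1) :
    f s ≤ s * f 1 + (1 - s) * f 0 := by
  have dy : ∀ n : ℕ, ∀ k : ℕ, k ≤ 2 ^ n →
      f (k / 2 ^ n) ≤ (k / 2 ^ n) * f 1 + (1 - k / 2 ^ n) * f 0 := by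
    intro n
    induction n with
    | zero =>
      intro k hk
      have : k = 0 ∨ k = 1 := by simp at hk; omega
      rcases this with rfl | rfl <;> simp
    | succ n ih =>
      intro k hk
      obtain ⟨a, b, hab, ha, hb⟩ : ∃ a b : ℕ, a + b = k ∧ a ≤ 2 ^ n ∧ b ≤ 2 ^ n :=
        ⟨k / 2, k - k / 2, by omega, by rw [pow_succ] at hk; omega, by rw [pow_succ] at hk; omega⟩
      have e : (k : ℝ) / 2 ^ (n + 1) = ((a : ℝ) / 2 ^ n + (b : ℝ) / 2 ^ n) / 2 := by
        rw [← hab]; push_cast; field_simp; ring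
      rw [e]
      have := hm ((a : ℝ) / 2 ^ n) ((b : ℝ) / 2 ^ n)
      have := ih a ha
      have := ih b hb
      linarith
  have lim : Tendsto (fun n : ℕ => ((⌊s * 2 ^ n⌋₊ : ℕ) : ℝ) / 2 ^ n) atTop (𝓝 s) := by
    refine (tendsto_nat_floor_mul_div_atTop h0).comp
      (tendsto_pow_atTop_atTop_of_one_lt (one_lt_two : (1 : ℝ) < 2))
  refine le_of_tendsto_of_tendsto' ((hf.tendsto s).comp lim)
    (((continuous_id.mul_const (f 1)).add
      ((continuous_const.sub continuous_id).mul_const (f 0))).tendsto s |>.comp lim) fun n => ?_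
  refine dy n _ ?_
  have : (⌊s * 2 ^ n⌋₊ : ℝ) ≤ 2 ^ n :=
    (Nat.floor_le (by positivity)).trans (mul_le_of_le_one_left (by positivity) h1)
  exact_mod_cast this

/-- Young's inequality for the trace. -/
lemma reTr_young (a b : M) (ha : IsSelfAdjoint a) (hb : IsSelfAdjoint b) {ε p : ℝ} (hε : 0 < ε)
    (hp : 1 ≤ p) :
    τ.reTr (shiftPow a ε (1 / 2) * shiftPow b ε ((p - 1) / 2)) ≤
      1 / p * τ.reTr (shiftPow a ε (p / 2)) + (1 - 1 / p) * τ.reTr (shiftPow b ε (p / 2)) := by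
  have hc : ∀ c : M, Continuous fun s => shiftPow c ε s := fun c =>
    tendsto_cfc_param (fun s t => (max t 0 + ε) ^ s)
      (Continuous.rpow (by fun_prop) (by fun_prop) fun z => Or.inl (by positivity)) c
  have h := le_chord
    (fun s => τ.reTr (shiftPow a ε (p * s / 2) * shiftPow b ε (p * (1 - s) / 2)))
    (τ.continuous_reTr.comp (((hc a).comp (by fun_prop)).mul ((hc b).comp (by fun_prop))))
    (fun s r => ?_) (s := 1 / p) (by positivity) ((div_le_one (by linarith)).2 hp)
  · have e1 : p * (1 / p) / 2 = 1 / 2 := by field_simp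
    have e2 : p * (1 - 1 / p) / 2 = (p - 1) / 2 := by field_simp
    simpa [e1, e2, shiftPow_zero, ha, hb, -one_div] using h
  · have h := τ.reTr_mul_le (shiftPow b ε (p * (1 - s) / 4) * shiftPow a ε (p * s / 4))
      (shiftPow a ε (p * r / 4) * shiftPow b ε (p * (1 - r) / 4))
    have k : ∀ (c d : M) (u v w z : ℝ),
        τ.reTr (shiftPow c ε u * shiftPow d ε v * (shiftPow d ε w * shiftPow c ε z)) =
          τ.reTr (shiftPow c ε (u + z) * shiftPow d ε (v + w)) := fun c d u v w z => by
      rw [add_comm u z, ← shiftPow_mul d hε v w, ← shiftPow_mul c hε z u, ← mul_assoc,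
        reTr_comm]
      simp only [mul_assoc]
    simp only [star_mul, shiftPow_star, k] at h
    have e1 : ∀ c : ℝ, p * c / 4 + p * c / 4 = p * c / 2 := fun c => by ring
    have e2 : p * s / 4 + p * r / 4 = p * ((s + r) / 2) / 2 := by ring
    have e3 : p * (1 - s) / 4 + p * (1 - r) / 4 = p * (1 - (s + r) / 2) / 2 := by ring
    rw [e1, e1, e1, e1, e2, e3] at h
    linarith [τ.reTr_comm (shiftPow b ε (p * (1 - r) / 2)) (shiftPow a ε (p * r / 2)),
      τ.reTr_comm (shiftPow b ε (p * (1 - s) / 2)) (shiftPow a ε (p * s / 2)),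
      τ.reTr_comm (shiftPow b ε (p * (1 - (s + r) / 2) / 2))
        (shiftPow a ε (p * ((s + r) / 2) / 2))]

lemma shiftPow_neg_one_mul_le (c : M) (hc : 0 ≤ c) {ε : ℝ} (hε : 0 < ε) :
    shiftPow c ε (-1) * c ≤ 1 := by
  have hs : IsSelfAdjoint c := .of_nonneg hc
  calc shiftPow c ε (-1) * c = cfc (fun t : ℝ => (max t 0 + ε) ^ (-1 : ℝ) * t) c := by
        rw [cfc_mul _ _ c (cont_shift hε _).continuousOn, cfc_id' ℝ c, shiftPow]
    _ ≤ cfc (fun _ : ℝ => (1 : ℝ)) c := by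
        refine cfc_mono (fun t _ => ?_) ((cont_shift hε _).mul continuous_id).continuousOn
        rw [Real.rpow_neg_one, inv_mul_le_iff₀ (by positivity)]
        have := le_max_left t 0
        linarith
    _ = 1 := cfc_const_one ℝ c

lemma shiftPow_intertwine (x : M) {ε : ℝ} (hε : 0 < ε) (s : ℝ) :
    x * shiftPow (star x * x) ε s = shiftPow (x * star x) ε s * x :=
  cfc_intertwine _ (cont_shift hε s) x

lemma reTr_shiftPow_sq (c d : M) {ε : ℝ} (hε : 0 < ε) (u v : ℝ) :
    τ.reTr (shiftPow c ε u * shiftPow d ε v * star (shiftPow c ε u * shiftPow d ε v)) =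
      τ.reTr (shiftPow c ε (u + u) * shiftPow d ε (v + v)) := by
  rw [← shiftPow_mul d hε, ← shiftPow_mul c hε, star_mul, shiftPow_star, shiftPow_star,
    ← mul_assoc, reTr_comm]
  simp only [mul_assoc]

lemma reTr_test_le (x z : M) {ε p : ℝ} (hε : 0 < ε) (hp : 1 ≤ p) :
    τ.reTr (shiftPow (star z * z) ε (p / 2 - 1) * star z * x) ≤
      1 / p * τ.reTr (shiftPow (star x * x) ε (p / 2)) +
        (1 - 1 / p) * τ.reTr (shiftPow (star z * z) ε (p / 2)) := by
  have hx := shiftPow_intertwine x hε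
  have hz := shiftPow_intertwine (star z) hε
  rw [star_star] at hz
  have hYx := τ.reTr_young (star x * x) (star z * z) (.star_mul_self x) (.star_mul_self z) hε hp
  have hYz := τ.reTr_young (x * star x) (z * star z) (.mul_star_self x) (.mul_star_self z) hε hp
  have sx : τ.reTr (shiftPow (star x * x) ε (p / 2)) = τ.reTr (shiftPow (x * star x) ε (p / 2)) :=
    τ.reTr_cfc_swap _ (cont_shift hε _) x
  have sz : τ.reTr (shiftPow (star z * z) ε (p / 2)) = τ.reTr (shiftPow (z * star z) ε (p / 2)) :=
    τ.reTr_cfc_swap _ (cont_shift hε _) z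
  rw [← sx, ← sz] at hYz
  have cC := shiftPow_neg_one_mul_le (x * star x) (mul_star_self_nonneg x) hε
  have cD := shiftPow_neg_one_mul_le (star z * z) (star_mul_self_nonneg z) hε
  have hsa : IsSelfAdjoint (star x * x) := .star_mul_self x
  generalize star x * x = a at *
  generalize hb : star z * z = b at *
  generalize ha' : x * star x = a' at *
  generalize z * star z = b' at *
  set q := (p - 1) / 4 with hq
  set P := shiftPow a ε (1 / 4) * shiftPow b ε q * (shiftPow b ε (-1 / 2) * star z) with hP
  set Q := shiftPow b' ε q * shiftPow a' ε (1 / 4) * (x * shiftPow a ε (-1 / 2)) with hQ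
  have e1 : shiftPow a' ε (1 / 4) * (x * shiftPow a ε (-1 / 2)) * shiftPow a ε (1 / 4) = x := by
    rw [← mul_assoc, ← hx, mul_assoc, mul_assoc, shiftPow_mul _ hε, shiftPow_mul _ hε]
    norm_num [shiftPow_zero, hsa]
  have e2 : shiftPow b ε q * (shiftPow b ε (-1 / 2) * star z) * shiftPow b' ε q
      = shiftPow b ε (p / 2 - 1) * star z := by
    rw [mul_assoc, mul_assoc, hz, ← mul_assoc, ← mul_assoc, shiftPow_mul _ hε,
      shiftPow_mul _ hε]
    congr 2; rw [hq]; ring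
  have h1 : τ.reTr (P * Q) = τ.reTr (shiftPow b ε (p / 2 - 1) * star z * x) := by
    rw [← e2]
    conv_rhs => rw [← e1]
    conv_rhs => rw [← mul_assoc, reTr_comm]
    simp only [hP, hQ, mul_assoc]
  have h2 : τ.reTr (P * star P) ≤ τ.reTr (shiftPow a ε (1 / 2) * shiftPow b ε ((p - 1) / 2)) := by
    have hz' : ∀ s, shiftPow b' ε s * z = z * shiftPow b ε s := fun s => by
      simpa [shiftPow_star] using congrArg star (hz s)
    have hD : shiftPow b ε (-1 / 2) * star z * star (shiftPow b ε (-1 / 2) * star z) ≤ 1 := by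
      refine le_of_eq_of_le ?_ cD
      rw [star_mul, star_star, shiftPow_star, mul_assoc, ← hz', ← mul_assoc (star z), hz,
        mul_assoc, hb, ← mul_assoc, shiftPow_mul _ hε]
      norm_num
    have := τ.reTr_mono (star_right_conjugate_le_conjugate hD (shiftPow a ε (1 / 4) * shiftPow b ε q))
    rw [mul_one, reTr_shiftPow_sq _ _ _ hε] at this
    rw [hP, star_mul]
    convert this using 2
    · simp only [mul_assoc]
    · congr 2 <;> [norm_num; (rw [hq]; ring)]
  have h3 : τ.reTr (star Q * Q) ≤ τ.reTr (shiftPow a' ε (1 / 2) * shiftPow b' ε ((p - 1) / 2)) := by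
    have hC : x * shiftPow a ε (-1 / 2) * star (x * shiftPow a ε (-1 / 2)) ≤ 1 := by
      refine le_of_eq_of_le ?_ cC
      rw [star_mul, shiftPow_star, mul_assoc, ← mul_assoc (shiftPow a ε _), shiftPow_mul _ hε,
        ← mul_assoc, hx, mul_assoc, ha']
      norm_num
    have := τ.reTr_mono (star_right_conjugate_le_conjugate hC (shiftPow b' ε q * shiftPow a' ε (1 / 4)))
    rw [mul_one, reTr_shiftPow_sq _ _ _ hε, reTr_comm _ (shiftPow b' ε _)] at this
    rw [reTr_comm, hQ, star_mul]
    convert this using 2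
    · simp only [mul_assoc]
    · congr 2 <;> [norm_num; (rw [hq]; ring)]
  have h4 := τ.reTr_mul_le P Q
  linarith

lemma reTr_one : τ.reTr 1 = 1 := congrArg Complex.re τ.map_one'

/-- `τ(|x| ^ p)`. -/
noncomputable def trAbsPow (p : ℝ) (x : M) : ℝ := τ.reTr (CFC.abs x ^ p)

lemma trAbsPow_eq {p : ℝ} (hp : 0 ≤ p) (x : M) :
    τ.trAbsPow p x = τ.reTr (cfc (fun t : ℝ => (max t 0) ^ (p / 2)) (star x * x)) := by
  lift p to NNReal using hp
  rw [trAbsPow, CFC.abs, CFC.rpow_sqrt_nnreal (star_mul_self_nonneg x),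
    CFC.rpow_eq_cfc_real (star_mul_self_nonneg x)]
  refine congrArg _ (cfc_congr fun t ht => ?_)
  rw [max_eq_left (spectrum_nonneg_of_nonneg (star_mul_self_nonneg x) ht)]

lemma tendsto_shiftPow {p : ℝ} (hp : 0 ≤ p) (x : M) :
    Tendsto (fun ε => τ.reTr (shiftPow (star x * x) ε (p / 2))) (𝓝[>] 0) (𝓝 (τ.trAbsPow p x)) := by
  have h : Continuous fun ε : ℝ =>
      τ.reTr (cfc (fun t : ℝ => (max t 0 + max ε 0) ^ (p / 2)) (star x * x)) :=
    τ.continuous_reTr.comp (tendsto_cfc_param (fun ε t => (max t 0 + max ε 0) ^ (p / 2))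
      (Continuous.rpow_const (by fun_prop) fun z => Or.inr (by positivity)) (star x * x))
  have h0 := (h.tendsto 0).mono_left (nhdsWithin_le_nhds (s := Ioi 0))
  have e0 : (fun t : ℝ => (max t 0 + max 0 0) ^ (p / 2)) = fun t => (max t 0) ^ (p / 2) := by
    simp
  rw [e0, ← trAbsPow_eq τ hp] at h0
  refine h0.congr' ?_
  filter_upwards [self_mem_nhdsWithin] with ε hε
  rw [shiftPow, max_eq_left (le_of_lt hε)]

lemma shiftPow_add_one (b : M) (hb : 0 ≤ b) {ε : ℝ} (hε : 0 < ε) (s : ℝ) :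
    shiftPow b ε (s + 1) = shiftPow b ε s * b + ε • shiftPow b ε s := by
  have hs : IsSelfAdjoint b := .of_nonneg hb
  have hc := (cont_shift hε s).continuousOn (s := spectrum ℝ b)
  calc shiftPow b ε (s + 1)
      = cfc (fun t : ℝ => (max t 0 + ε) ^ s * t + ε * (max t 0 + ε) ^ s) b := by
        refine cfc_congr fun t ht => ?_
        have ht0 : 0 ≤ t := spectrum_nonneg_of_nonneg hb ht
        simp only [max_eq_left ht0]
        rw [Real.rpow_add_one (by positivity)]; ring
    _ = shiftPow b ε s * b + ε • shiftPow b ε s := by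
        rw [cfc_add b (fun t : ℝ => (max t 0 + ε) ^ s * t) (fun t => ε * (max t 0 + ε) ^ s)
          (hc.mul continuousOn_id) (continuousOn_const.mul hc),
          cfc_mul (fun t : ℝ => (max t 0 + ε) ^ s) (fun t => t) b hc continuousOn_id,
          cfc_id' ℝ b, cfc_const_mul _ _ b hc, shiftPow]

lemma reTr_shiftPow_small {r : ℝ} (z : M) :
    ∃ C : ℝ, ∀ ε : ℝ, 0 < ε → ε ≤ 1 →
      ε * τ.reTr (shiftPow (star z * z) ε (r - 1)) ≤ ε ^ r + ε * C := by
  refine ⟨(‖star z * z‖ + 1) ^ (r - 1), fun ε hε hε1 => ?_⟩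
  have h : shiftPow (star z * z) ε (r - 1) ≤
      cfc (fun _ : ℝ => ε ^ (r - 1) + (‖star z * z‖ + 1) ^ (r - 1)) (star z * z) := by
    refine cfc_mono (fun t ht => ?_) (cont_shift hε _).continuousOn continuousOn_const
    have ht0 : 0 ≤ t := spectrum_nonneg_of_nonneg (star_mul_self_nonneg z) ht
    have htK : t ≤ ‖star z * z‖ := by
      obtain h | h := subsingleton_or_nontrivial M
      · rw [spectrum.of_subsingleton] at ht; exact ht.elim
      · exact (le_abs_self t).trans (spectrum.norm_le_norm_of_mem ht)
    rw [max_eq_left ht0]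
    rcases le_total (r - 1) 0 with hr | hr
    · have := Real.rpow_le_rpow_of_nonpos hε (show ε ≤ t + ε by linarith) hr
      have : 0 ≤ (‖star z * z‖ + 1) ^ (r - 1) := by positivity
      linarith
    · have := Real.rpow_le_rpow (by positivity) (show t + ε ≤ ‖star z * z‖ + 1 by linarith) hr
      have : 0 ≤ ε ^ (r - 1) := by positivity
      linarith
  have h2 := τ.reTr_mono h
  rw [cfc_const _ _ (.star_mul_self z), Algebra.algebraMap_eq_smul_one, reTr_smul, reTr_one,
    mul_one] at h2
  have e : ε ^ r = ε * ε ^ (r - 1) := by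
    rw [Real.rpow_sub_one hε.ne']; field_simp
  rw [e, ← mul_add]
  exact mul_le_mul_of_nonneg_left h2 hε.le

lemma trAbsPow_convex {p : ℝ} (hp : 1 ≤ p) (x y : M) {s : ℝ} (h0 : 0 ≤ s) (h1 : s ≤ 1) :
    τ.trAbsPow p (s • x + (1 - s) • y) ≤ s * τ.trAbsPow p x + (1 - s) * τ.trAbsPow p y := by
  obtain ⟨z, hz⟩ : ∃ z, z = s • x + (1 - s) • y := ⟨_, rfl⟩
  rw [← hz]
  have hp0 : 0 < p := by linarith
  obtain ⟨C, hC⟩ := τ.reTr_shiftPow_small (r := p / 2) z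
  have key : ∀ ε : ℝ, 0 < ε → ε ≤ 1 → τ.reTr (shiftPow (star z * z) ε (p / 2)) ≤
      s * τ.reTr (shiftPow (star x * x) ε (p / 2)) +
        (1 - s) * τ.reTr (shiftPow (star y * y) ε (p / 2)) + p * (ε ^ (p / 2) + ε * C) := by
    intro ε hε hε1
    have hx := τ.reTr_test_le x z hε hp
    have hy := τ.reTr_test_le y z hε hp
    have e1 : τ.reTr (shiftPow (star z * z) ε (p / 2 - 1) * star z * z) =
        s * τ.reTr (shiftPow (star z * z) ε (p / 2 - 1) * star z * x) +
        (1 - s) * τ.reTr (shiftPow (star z * z) ε (p / 2 - 1) * star z * y) := by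
      have : ∀ w : M, w * z = s • (w * x) + (1 - s) • (w * y) := fun w => by
        rw [hz, mul_add, mul_smul_comm, mul_smul_comm]
      rw [this, reTr_add, reTr_smul, reTr_smul]
    have e2 : shiftPow (star z * z) ε (p / 2) = shiftPow (star z * z) ε (p / 2 - 1) * star z * z +
        ε • shiftPow (star z * z) ε (p / 2 - 1) := by
      rw [mul_assoc, ← shiftPow_add_one _ (star_mul_self_nonneg z) hε, sub_add_cancel]
    have e3 := congrArg τ.reTr e2
    rw [reTr_add, reTr_smul, e1] at e3
    have e4 := hC ε hε hε1
    have := mul_le_mul_of_nonneg_left hx h0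
    have := mul_le_mul_of_nonneg_left hy (sub_nonneg.2 h1)
    have fin : 1 / p * τ.reTr (shiftPow (star z * z) ε (p / 2)) ≤
      1 / p * (s * τ.reTr (shiftPow (star x * x) ε (p / 2)) +
        (1 - s) * τ.reTr (shiftPow (star y * y) ε (p / 2))) + (ε ^ (p / 2) + ε * C) := by
      linarith
    have := mul_le_mul_of_nonneg_left fin hp0.le
    have e5 : ∀ u : ℝ, p * (1 / p * u) = u := fun u => by field_simp
    rwa [mul_add, e5, e5] at this
  have hlim : Tendsto (fun ε : ℝ => p * (ε ^ (p / 2) + ε * C)) (𝓝[>] 0) (𝓝 0) := by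
    have hc : Continuous fun ε : ℝ => p * (ε ^ (p / 2) + ε * C) :=
      continuous_const.mul ((Real.continuous_rpow_const (by positivity)).add (by fun_prop))
    have := (hc.tendsto 0).mono_left (nhdsWithin_le_nhds (s := Ioi 0))
    simpa [Real.zero_rpow (show p / 2 ≠ 0 by positivity)] using this
  have R := ((((τ.tendsto_shiftPow hp0.le x).const_mul s).add
    ((τ.tendsto_shiftPow hp0.le y).const_mul (1 - s))).add hlim)
  rw [add_zero] at R
  refine le_of_tendsto_of_tendsto (τ.tendsto_shiftPow hp0.le z) R ?_
  filter_upwards [self_mem_nhdsWithin, Ioc_mem_nhdsGT (zero_lt_one' ℝ)] with ε hε hε1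
  exact key ε hε hε1.2

lemma trAbsPow_nonneg (p : ℝ) (x : M) : 0 ≤ τ.trAbsPow p x := τ.reTr_nonneg CFC.rpow_nonneg

lemma smul_rpow {p r : ℝ} (hp : 0 < p) (hr : 0 ≤ r) (a : M) (ha : 0 ≤ a) :
    (r • a) ^ p = r ^ p • a ^ p := by
  have hs : IsSelfAdjoint a := .of_nonneg ha
  have hc : Continuous fun t : ℝ => t ^ p := Real.continuous_rpow_const hp.le
  rw [CFC.rpow_eq_cfc_real (smul_nonneg hr ha), CFC.rpow_eq_cfc_real ha,
    ← cfc_comp_const_mul r (fun t : ℝ => t ^ p) a hc.continuousOn hs,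
    ← cfc_const_mul _ _ a hc.continuousOn]
  refine cfc_congr fun t ht => ?_
  exact Real.mul_rpow hr (spectrum_nonneg_of_nonneg ha ht)

lemma trAbsPow_smul {p : ℝ} (hp : 0 < p) (c : ℂ) (x : M) :
    τ.trAbsPow p (c • x) = ‖c‖ ^ p * τ.trAbsPow p x := by
  rw [trAbsPow, trAbsPow, ← reTr_smul, CFC.abs_smul,
    smul_rpow hp (norm_nonneg c) _ (CFC.abs_nonneg x)]

lemma eq_zero_of_trAbsPow {p : ℝ} (hp : 0 < p) {x : M} (h : τ.trAbsPow p x = 0) : x = 0 := by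
  have h1 : star (CFC.abs x ^ (p / 2)) * CFC.abs x ^ (p / 2) = CFC.abs x ^ p := by
    rw [(IsSelfAdjoint.of_nonneg CFC.rpow_nonneg).star_eq, ← sq, ← CFC.rpow_natCast _ _ CFC.rpow_nonneg,
      CFC.rpow_rpow_of_exponent_nonneg _ _ _ (by positivity) (by positivity) (CFC.abs_nonneg x)]
    congr 1; push_cast; ring
  have h2 : τ.toPositiveLinearMap (CFC.abs x ^ p) = 0 := by
    have := Complex.le_def.1 (τ.toPositiveLinearMap.map_nonneg (CFC.rpow_nonneg (a := CFC.abs x)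
      (y := p)))
    exact Complex.ext h this.2.symm
  have h3 := τ.faithful' _ (by rw [h1]; exact h2)
  have h4 := congrArg (fun a : M => a ^ (2 / p)) h3
  beta_reduce at h4
  rw [CFC.rpow_rpow_of_exponent_nonneg _ _ _ (by positivity) (by positivity) (CFC.abs_nonneg x),
    show p / 2 * (2 / p) = 1 by field_simp, CFC.rpow_one _ (CFC.abs_nonneg x)] at h4
  exact CFC.abs_eq_zero_iff.1 (h4.trans (CFC.zero_rpow (by positivity)))

lemma pNorm_of_ne_top {p : ℝ≥0∞} (hp : p ≠ ∞) (x : M) :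
    τ.pNorm p x = τ.trAbsPow p.toReal x ^ (1 / p.toReal) := if_neg hp

lemma pNorm_nonneg (p : ℝ≥0∞) (x : M) : 0 ≤ τ.pNorm p x := by
  rw [pNorm]; split_ifs with h
  · exact norm_nonneg x
  · exact Real.rpow_nonneg (τ.trAbsPow_nonneg _ x) _

lemma pNorm_smul {p : ℝ≥0∞} (hp : 1 ≤ p) (c : ℂ) (x : M) :
    τ.pNorm p (c • x) = ‖c‖ * τ.pNorm p x := by
  by_cases h : p = ∞
  · simp [pNorm, h, norm_smul]
  · have h0 : 0 < p.toReal := ENNReal.toReal_pos (zero_lt_one.trans_le hp).ne' h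
    rw [pNorm_of_ne_top τ h, pNorm_of_ne_top τ h, trAbsPow_smul τ h0,
      Real.mul_rpow (by positivity) (τ.trAbsPow_nonneg _ x), ← Real.rpow_mul (norm_nonneg c),
      mul_one_div_cancel h0.ne', Real.rpow_one]

lemma eq_zero_of_pNorm {p : ℝ≥0∞} (hp : 1 ≤ p) {x : M} (hx : τ.pNorm p x = 0) : x = 0 := by
  by_cases h : p = ∞
  · simpa [pNorm, h] using hx
  · have h0 : 0 < p.toReal := ENNReal.toReal_pos (zero_lt_one.trans_le hp).ne' h
    rw [pNorm_of_ne_top τ h, Real.rpow_eq_zero (τ.trAbsPow_nonneg _ x) (by positivity)] at hx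
    exact τ.eq_zero_of_trAbsPow h0 hx

lemma trAbsPow_le_one_iff {p : ℝ≥0∞} (hp : 1 ≤ p) (h : p ≠ ∞) (x : M) :
    τ.trAbsPow p.toReal x ≤ 1 ↔ τ.pNorm p x ≤ 1 := by
  have h0 : 0 < p.toReal := ENNReal.toReal_pos (zero_lt_one.trans_le hp).ne' h
  rw [pNorm_of_ne_top τ h]
  refine ⟨fun h1 => Real.rpow_le_one (τ.trAbsPow_nonneg _ x) h1 (by positivity), fun h1 => ?_⟩
  by_contra! h2
  exact absurd h1 (not_le.2 (Real.one_lt_rpow h2 (by positivity)))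

/-- Minkowski's inequality for the trace. -/
lemma pNorm_add_le {p : ℝ≥0∞} (hp : 1 ≤ p) (x y : M) :
    τ.pNorm p (x + y) ≤ τ.pNorm p x + τ.pNorm p y := by
  by_cases h : p = ∞
  · simpa [pNorm, h] using norm_add_le x y
  have hr : 1 ≤ p.toReal := (ENNReal.toReal_le_toReal ENNReal.one_ne_top h).2 hp
  rcases (τ.pNorm_nonneg p x).eq_or_lt' with hx | hx
  · rw [hx, τ.eq_zero_of_pNorm hp hx, zero_add, zero_add]
  rcases (τ.pNorm_nonneg p y).eq_or_lt' with hy | hy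
  · rw [hy, τ.eq_zero_of_pNorm hp hy, add_zero, add_zero]
  set A := τ.pNorm p x
  set B := τ.pNorm p y
  have hsm : ∀ (r : ℝ) (w : M), 0 ≤ r → τ.pNorm p (r • w) = r * τ.pNorm p w := fun r w h0 => by
    have := τ.pNorm_smul hp (r : ℂ) w
    rwa [Complex.norm_of_nonneg h0, Complex.coe_smul] at this
  have e : (A + B)⁻¹ • (x + y) = (A / (A + B)) • (A⁻¹ • x) + (1 - A / (A + B)) • (B⁻¹ • y) := by
    rw [smul_smul, smul_smul, smul_add]
    congr 2 <;> field_simp; ring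
  have c := τ.trAbsPow_convex hr (A⁻¹ • x) (B⁻¹ • y) (s := A / (A + B)) (by positivity)
    ((div_le_one (by positivity)).2 (by linarith))
  rw [← e] at c
  have hA : τ.trAbsPow p.toReal (A⁻¹ • x) ≤ 1 := by
    rw [trAbsPow_le_one_iff τ hp h, hsm _ _ (by positivity), inv_mul_cancel₀ hx.ne']
  have hB : τ.trAbsPow p.toReal (B⁻¹ • y) ≤ 1 := by
    rw [trAbsPow_le_one_iff τ hp h, hsm _ _ (by positivity), inv_mul_cancel₀ hy.ne']
  have hs0 : 0 ≤ A / (A + B) := by positivity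
  have hs1 : 0 ≤ 1 - A / (A + B) := sub_nonneg.2 ((div_le_one (by positivity)).2 (by linarith))
  have c2 : τ.trAbsPow p.toReal ((A + B)⁻¹ • (x + y)) ≤ 1 := by nlinarith
  rw [trAbsPow_le_one_iff τ hp h, hsm _ _ (by positivity), inv_mul_le_iff₀ (by positivity),
    mul_one] at c2
  exact c2

end TraceNorm

end FaithfulNormalTracialState

/-! ### The spaces `L^p(M, τ)` -/

/-- The algebra `M` regarded as a normed space with the norm `‖·‖_p`. -/
def WithPNorm {M : Type*} [CStarAlgebra M] [PartialOrder M] [StarOrderedRing M]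
    (_τ : FaithfulNormalTracialState M) (_p : ℝ≥0∞) : Type _ := M

section WithPNorm

variable {M : Type*} [CStarAlgebra M] [PartialOrder M] [StarOrderedRing M]
  (τ : FaithfulNormalTracialState M) (p : ℝ≥0∞)

instance : AddCommGroup (WithPNorm τ p) := inferInstanceAs (AddCommGroup M)

instance : Module ℂ (WithPNorm τ p) := inferInstanceAs (Module ℂ M)

noncomputable instance : Norm (WithPNorm τ p) := ⟨fun x => τ.pNorm p (x : M)⟩

lemma WithPNorm.core [Fact (1 ≤ p)] : NormedSpace.Core ℂ (WithPNorm τ p) where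
  norm_nonneg x := τ.pNorm_nonneg p x
  norm_smul c x := τ.pNorm_smul Fact.out c x
  norm_triangle x y := τ.pNorm_add_le Fact.out x y
  norm_eq_zero_iff x := by
    refine ⟨fun h => τ.eq_zero_of_pNorm Fact.out h, fun h => ?_⟩
    have := τ.pNorm_smul (p := p) Fact.out 0 0
    rw [zero_smul, norm_zero, zero_mul] at this
    rw [h]
    exact this

noncomputable instance [Fact (1 ≤ p)] : NormedAddCommGroup (WithPNorm τ p) :=
  NormedAddCommGroup.ofCore (WithPNorm.core τ p)

noncomputable instance [Fact (1 ≤ p)] : NormedSpace ℂ (WithPNorm τ p) :=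
  NormedSpace.ofCore (WithPNorm.core τ p)

/-- `L^p(M, τ)`, the completion of `M` for the norm `‖·‖_p`. -/
abbrev TraceLp [Fact (1 ≤ p)] : Type _ := UniformSpace.Completion (WithPNorm τ p)

/-- The identity map of `M`, with values in `M` normed by `‖·‖_p`. -/
def toWithPNorm (x : M) : WithPNorm τ p := x

/-- The canonical inclusion of `M` in `L^p(M, τ)`. -/
noncomputable def toTraceLp [Fact (1 ≤ p)] (x : M) : TraceLp τ p := (toWithPNorm τ p x : TraceLp τ p)

lemma norm_toTraceLp [Fact (1 ≤ p)] (x : M) : ‖toTraceLp τ p x‖ = τ.pNorm p x :=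
  UniformSpace.Completion.norm_coe (toWithPNorm τ p x)

end WithPNorm

/-! ### The operator `F(ad w)`, where `F(z) = sinh z / z` -/

/-- The entire function `F(z) = sinh z / z = ∑ z ^ (2n) / (2n + 1)!`, evaluated at an element of a
Banach algebra. -/
noncomputable def sinhDiv {A : Type*} [NormedRing A] [NormedAlgebra ℂ A] (T : A) : A :=
  ∑' n : ℕ, (((2 * n + 1).factorial : ℂ)⁻¹) • T ^ (2 * n)

/-- The series in the definition of `sinhDiv` always converges. -/
lemma hasSum_sinhDiv {A : Type*} [NormedRing A] [NormedAlgebra ℂ A] [CompleteSpace A] (T : A) :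
    HasSum (fun n : ℕ => (((2 * n + 1).factorial : ℂ)⁻¹) • T ^ (2 * n)) (sinhDiv T) := by
  refine Summable.hasSum (Summable.of_norm ?_)
  have h := (NormedSpace.norm_expSeries_summable' (𝕂 := ℂ) T).comp_injective
    (i := fun n : ℕ => 2 * n) (fun a b h => by simpa using h)
  refine Summable.of_nonneg_of_le (fun _ => norm_nonneg _) (fun n => ?_) h
  simp only [Function.comp_apply, norm_smul, norm_inv, Complex.norm_natCast]
  gcongr
  omega

/-- `ad w : y ↦ w y - y w`, as a bounded operator on `M`. -/
noncomputable def adOp {M : Type*} [CStarAlgebra M] (w : M) : M →L[ℂ] M :=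
  ContinuousLinearMap.mul ℂ M w - (ContinuousLinearMap.mul ℂ M).flip w

lemma adOp_apply {M : Type*} [CStarAlgebra M] (w y : M) : adOp w y = w * y - y * w := rfl

/-! ### Curves, lengths and the geodesic distance -/

/-- A curve `γ : [0, 1] → E` is piecewise smooth if it is continuous and `[0, 1]` can be subdivided
into finitely many closed intervals, on each of which `γ` is `C^1` with nowhere vanishing derivative
(one-sided derivatives at the end points). -/
def IsPiecewiseSmooth {E : Type*} [NormedAddCommGroup E] [NormedSpace ℝ E] (γ : ℝ → E) : Prop :=
  ContinuousOn γ (Icc 0 1) ∧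
    ∃ (n : ℕ) (t : ℕ → ℝ), t 0 = 0 ∧ t n = 1 ∧ ∀ i < n, t i < t (i + 1) ∧
      ContDiffOn ℝ 1 γ (Icc (t i) (t (i + 1))) ∧
      ∀ s ∈ Icc (t i) (t (i + 1)), derivWithin γ (Icc (t i) (t (i + 1))) s ≠ 0

section Length

variable {M : Type*} [CStarAlgebra M] [PartialOrder M] [StarOrderedRing M]
  (τ : FaithfulNormalTracialState M) (p : ℝ≥0∞)

/-- The linear `p`-length `∫₀¹ ‖Γ'(t)‖_p dt`. -/
noncomputable def linearLength (Γ : ℝ → M) : ℝ≥0∞ :=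
  ∫⁻ t in Icc (0 : ℝ) 1, ENNReal.ofReal (τ.pNorm p (derivWithin Γ (Icc 0 1) t))

/-- The Finsler norm `‖x‖_{a,p} = ‖a^(-1/2) x a^(-1/2)‖_p` of a tangent vector `x` at `a`. -/
noncomputable def finslerNorm (a x : M) : ℝ :=
  τ.pNorm p (a ^ (-(1 / 2) : ℝ) * x * a ^ (-(1 / 2) : ℝ))

/-- The Finsler length `∫₀¹ ‖γ'(t)‖_{γ(t),p} dt` of a curve of positive invertible elements. -/
noncomputable def finslerLength (γ : ℝ → M) : ℝ≥0∞ :=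
  ∫⁻ t in Icc (0 : ℝ) 1, ENNReal.ofReal (finslerNorm τ p (γ t) (derivWithin γ (Icc 0 1) t))

/-- The geodesic distance `d_p(a, b)`: the infimum of the Finsler lengths of the piecewise smooth
curves of positive invertible elements that join `a` to `b`. -/
noncomputable def geodesicDist (a b : M) : ℝ≥0∞ :=
  ⨅ (γ : ℝ → M) (_ : IsPiecewiseSmooth γ) (_ : ∀ t ∈ Icc (0 : ℝ) 1, IsStrictlyPositive (γ t))
    (_ : γ 0 = a) (_ : γ 1 = b), finslerLength τ p γ

end Length

/-! The core is an operator-theoretic fact: if `exp (i s T)` is a contraction for every real `s`,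
then `F(T) = sinh T / T` is invertible and expansive. Indeed `F(z)` is the limit of the polynomials
`((1 + z / n) ^ n - (1 - z / n) ^ n) / (2 z)`. At a root, `1 + z / n` and `1 - z / n` have equal
modulus, so all roots are imaginary, and each polynomial is a product of factors `1 - i s z` with
`s` real. Each operator `1 - i s T` is expansive because `i s T` is dissipative, and invertible by a
connectedness argument in `s`. Products and norm limits of expansive invertible operators are again
of this kind (`isExpansiveUnit_sinhDiv`).

For self-adjoint `w`, `exp (i s ad w)` is conjugation by the unitary `exp (i s w)`, which preserves
every `‖·‖_p`. The fact therefore applies to `T = ad w`, both on `M` with the uniform norm and on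
`L^p`.

Geometry enters through the differential of the exponential, `y ↦ e^(w/2) F(ad (w/2))(y) e^(w/2)`.
The Finsler norm at `e^w` strips off exactly the outer factors, so the speed of `e^Γ` is `‖F(ad
(Γ/2)) Γ'‖_p`, which is at least `‖Γ'‖_p`. Invertibility on `M` makes `exp` a local diffeomorphism
at self-adjoint points, so `Γ` inherits the smoothness of `γ`. For the distance bound, every curve
of positive invertible elements is the exponential of its logarithm, and the linear length of a
curve is at least the norm of the difference of its end points. -/

/-! ### Expansive invertible operators -/

section Expansive

variable {E : Type*} [NormedAddCommGroup E] [NormedSpace ℂ E]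

/-- An invertible operator which does not decrease norms. -/
def IsExpansiveUnit (U : E →L[ℂ] E) : Prop := IsUnit U ∧ ∀ z, ‖z‖ ≤ ‖U z‖

namespace IsExpansiveUnit

lemma one : IsExpansiveUnit (1 : E →L[ℂ] E) := ⟨isUnit_one, fun _ => le_rfl⟩

lemma mul {U V : E →L[ℂ] E} (hU : IsExpansiveUnit U) (hV : IsExpansiveUnit V) :
    IsExpansiveUnit (U * V) :=
  ⟨hU.1.mul hV.1, fun z => (hV.2 z).trans (hU.2 (V z))⟩

/-- Norm limits of expansive invertible operators are expansive and invertible. -/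
lemma of_tendsto [CompleteSpace E] {ι : Type*} {l : Filter ι} [l.NeBot] {U : ι → E →L[ℂ] E}
    {A : E →L[ℂ] E} (h : Tendsto U l (𝓝 A)) (hU : ∀ᶠ i in l, IsExpansiveUnit (U i)) :
    IsExpansiveUnit A := by
  refine ⟨?_, fun z => ?_⟩
  · have hd := (tendsto_iff_norm_sub_tendsto_zero.1 h).eventually (gt_mem_nhds zero_lt_one)
    obtain ⟨i, hi, ⟨⟨u, hu⟩, hexp⟩⟩ := (hd.and hU).exists
    -- Expansiveness bounds the inverses by 1 uniformly in `i`, so a single `U i` at distance less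
    -- than 1 from `A` suffices for a Neumann series.
    have hinv : ‖(↑u⁻¹ : E →L[ℂ] E)‖ ≤ 1 := by
      refine ContinuousLinearMap.opNorm_le_bound _ zero_le_one fun z => ?_
      have h1 := hexp ((↑u⁻¹ : E →L[ℂ] E) z)
      rw [← hu, ← mul_apply_eq_comp, Units.mul_inv] at h1
      simpa using h1
    have hA : A = u * (1 - (↑u⁻¹ : E →L[ℂ] E) * (U i - A)) := by
      rw [mul_sub, ← mul_assoc, Units.mul_inv, hu]; simp
    rw [hA]
    refine u.isUnit.mul (isUnit_one_sub_of_norm_lt_one ?_)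
    exact ((norm_mul_le _ _).trans (mul_le_of_le_one_left (norm_nonneg _) hinv)).trans_lt hi
  · have h1 : Tendsto (fun i => ‖U i z‖) l (𝓝 ‖A z‖) :=
      ((ContinuousLinearMap.apply ℂ E z).continuous.tendsto A |>.comp h).norm
    exact ge_of_tendsto h1 (hU.mono fun i hi => hi.2 z)

end IsExpansiveUnit

lemma hasDerivAt_exp_smul_zero {A : Type*} [NormedRing A] [NormedAlgebra ℂ A] [CompleteSpace A]
    (T : A) : HasDerivAt (fun r : ℝ => NormedSpace.exp (r • T)) T 0 := by
  simpa using hasDerivAt_exp_smul_const (𝕂 := ℝ) T (0 : ℝ)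

/-- If `A` generates a semigroup of contractions then `1 - A` is expansive. -/
lemma norm_le_norm_sub_of_exp_contraction [CompleteSpace E] (A : E →L[ℂ] E)
    (hA : ∀ r : ℝ, 0 ≤ r → ‖NormedSpace.exp (r • A)‖ ≤ 1) (z : E) : ‖z‖ ≤ ‖z - A z‖ := by
  -- With `φ` norming `z`, the function `Re φ(exp (r A) z)` is at most `‖z‖` for `r ≥ 0`, with
  -- equality at `r = 0`. Hence its derivative `Re φ(A z)` at 0 is nonpositive: `A` is dissipative.
  obtain ⟨φ, hφ, hz⟩ := exists_dual_vector'' ℂ z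
  have hd : HasDerivAt (fun r : ℝ => (φ (NormedSpace.exp (r • A) z)).re) (φ (A z)).re 0 := by
    have h1 := hasDerivAt_exp_smul_zero A
    let L : (E →L[ℂ] E) →L[ℝ] ℝ :=
      Complex.reCLM.comp ((φ.comp (ContinuousLinearMap.apply ℂ E z)).restrictScalars ℝ)
    exact (L.hasFDerivAt.comp_hasDerivAt (0 : ℝ) h1)
  have hle : (φ (A z)).re ≤ 0 := by
    refine le_of_tendsto ((hasDerivWithinAt_iff_tendsto_slope' (by simp)).1
      (hd.hasDerivWithinAt (s := Ioi 0))) ?_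
    · filter_upwards [self_mem_nhdsWithin] with r hr
      have hr0 : 0 < r := hr
      rw [slope_def_field]
      refine div_nonpos_of_nonpos_of_nonneg ?_ (by linarith)
      have h2 : (φ (NormedSpace.exp ((0 : ℝ) • A) z)).re = ‖z‖ := by
        simp [NormedSpace.exp_zero, hz]
      have h3 : (φ (NormedSpace.exp (r • A) z)).re ≤ ‖z‖ :=
        calc _ ≤ ‖φ (NormedSpace.exp (r • A) z)‖ := Complex.re_le_norm _
          _ ≤ ‖φ‖ * ‖NormedSpace.exp (r • A) z‖ := φ.le_opNorm _
          _ ≤ 1 * (1 * ‖z‖) := by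
              gcongr
              exact (ContinuousLinearMap.le_opNorm _ _).trans (by gcongr; exact hA r hr0.le)
          _ = ‖z‖ := by simp
      rw [h2]; linarith
  calc ‖z‖ ≤ (φ (z - A z)).re := by
        rw [map_sub, Complex.sub_re, hz]; simpa using hle
    _ ≤ ‖φ (z - A z)‖ := Complex.re_le_norm _
    _ ≤ ‖φ‖ * ‖z - A z‖ := φ.le_opNorm _
    _ ≤ ‖z - A z‖ := mul_le_of_le_one_left (norm_nonneg _) hφ

/-- If `exp (i s T)` is a contraction for all real `s`, then `1 - i s T` is expansive and
invertible. -/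
lemma isExpansiveUnit_one_sub [CompleteSpace E] (T : E →L[ℂ] E)
    (hT : ∀ s : ℝ, ‖NormedSpace.exp (((s : ℂ) * Complex.I) • T)‖ ≤ 1) (s : ℝ) :
    IsExpansiveUnit (1 - ((s : ℂ) * Complex.I) • T) := by
  have hexp : ∀ s : ℝ, ∀ z, ‖z‖ ≤ ‖(1 - ((s : ℂ) * Complex.I) • T) z‖ := fun s z => by
    refine norm_le_norm_sub_of_exp_contraction (((s : ℂ) * Complex.I) • T) (fun r _ => ?_) z
    have : r • ((s : ℂ) * Complex.I) • T = (((r * s : ℝ) : ℂ) * Complex.I) • T := by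
      rw [← Complex.coe_smul, smul_smul]; push_cast; ring_nf
    rw [this]; exact hT _
  have hc : Continuous fun s : ℝ => (1 : E →L[ℂ] E) - ((s : ℂ) * Complex.I) • T := by fun_prop
  -- Units form an open set, and expansiveness, known for all `s`, makes invertibility a closed
  -- condition. The set contains `s = 0`, so connectedness of the line gives every `s`.
  have hclopen : IsClopen {s : ℝ | IsUnit ((1 : E →L[ℂ] E) - ((s : ℂ) * Complex.I) • T)} := by
    refine ⟨isClosed_iff_frequently.2 fun x hx => ?_, Units.isOpen.preimage hc⟩
    have hne : (𝓝[{s : ℝ | IsUnit ((1 : E →L[ℂ] E) - ((s : ℂ) * Complex.I) • T)}] x).NeBot :=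
      mem_closure_iff_nhdsWithin_neBot.1 (mem_closure_iff_frequently.2 hx)
    exact (@IsExpansiveUnit.of_tendsto _ _ _ _ _ _ hne _ _
      ((hc.tendsto x).mono_left nhdsWithin_le_nhds)
      (eventually_mem_nhdsWithin.mono fun s hs => ⟨hs, hexp s⟩)).1
  have huniv := hclopen.eq_univ ⟨0, by simp⟩
  exact ⟨(Set.eq_univ_iff_forall.1 huniv s :), hexp s⟩

open Polynomial in
/-- A polynomial normalised by `q 0 = 1` whose roots are imaginary is a product of factors
`1 - i s X`. -/
lemma isExpansiveUnit_aeval [CompleteSpace E] (T : E →L[ℂ] E)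
    (hT : ∀ s : ℝ, ‖NormedSpace.exp (((s : ℂ) * Complex.I) • T)‖ ≤ 1) :
    ∀ (n : ℕ) (q : ℂ[X]), q.natDegree = n → q.eval 0 = 1 → (∀ z, q.eval z = 0 → z.re = 0) →
      IsExpansiveUnit (aeval T q) := by
  intro n
  induction n with
  | zero =>
    intro q hq h0 _
    rw [eq_C_of_natDegree_eq_zero hq, eval_C] at h0
    rw [eq_C_of_natDegree_eq_zero hq, h0]
    simpa using IsExpansiveUnit.one
  | succ n ih =>
    intro q hq h0 hr
    obtain ⟨z, hz⟩ := IsAlgClosed.exists_root q (by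
      intro h; rw [natDegree_eq_of_degree_eq_some h] at hq; simp at hq)
    obtain ⟨q', rfl⟩ := dvd_iff_isRoot.2 hz
    have hz0 : z ≠ 0 := by rintro rfl; simp at h0
    have hq'0 : q' ≠ 0 := by rintro rfl; simp at h0
    have hzre := hr z hz
    -- Moving the constant `-z` into the cofactor restores the normalisation to value 1 at 0, so the
    -- induction hypothesis applies; `z⁻¹` is again imaginary, hence of the form `i s`.
    have e : (X - C z) * q' = (1 - C z⁻¹ * X) * (C (-z) * q') := by
      have : (C z⁻¹ : ℂ[X]) * C z = 1 := by rw [← C_mul, inv_mul_cancel₀ hz0, C_1]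
      rw [C_neg]
      linear_combination (-X * q' : ℂ[X]) * this
    rw [e, map_mul]
    refine IsExpansiveUnit.mul ?_ (ih _ ?_ ?_ ?_)
    · have hs : z⁻¹ = ((z⁻¹.im : ℝ) : ℂ) * Complex.I := by
        apply Complex.ext <;> simp [Complex.inv_re, hzre]
      have := isExpansiveUnit_one_sub T hT z⁻¹.im
      rw [← hs] at this
      simpa [Algebra.smul_def] using this
    · rw [natDegree_mul (X_sub_C_ne_zero z) hq'0, natDegree_X_sub_C] at hq
      rw [natDegree_C_mul (neg_ne_zero.2 hz0)]; omega
    · simpa using h0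
    · intro x hx
      refine hr x ?_
      rw [e, eval_mul, hx, mul_zero]

end Expansive

/-! ### Approximation of `sinh z / z` by polynomials with imaginary roots -/

section SinhDiv
open Polynomial

/-- The even polynomial `((1 + X / n) ^ n - (1 - X / n) ^ n) / (2 X)`. -/
noncomputable def sinhDivPoly (n : ℕ) : ℂ[X] :=
  ∑ j ∈ Finset.range (n + 1), C ((n.choose (2 * j + 1) : ℂ) / n ^ (2 * j + 1)) * X ^ (2 * j)

lemma sum_range_two_mul {A : Type*} [AddCommMonoid A] (f : ℕ → A) (k : ℕ) :
    ∑ m ∈ Finset.range (2 * k), f m = ∑ j ∈ Finset.range k, (f (2 * j) + f (2 * j + 1)) := by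
  induction k with
  | zero => simp
  | succ k ih => rw [Finset.sum_range_succ, ← ih, mul_add_one, Finset.sum_range_succ,
      Finset.sum_range_succ, add_assoc]

lemma one_add_pow_eq_sum (u : ℂ) {n N : ℕ} (h : n + 1 ≤ N) :
    (1 + u) ^ n = ∑ m ∈ Finset.range N, u ^ m * n.choose m := by
  rw [add_comm, add_pow]
  simp only [one_pow, mul_one]
  refine Finset.sum_subset (by simpa using h) fun m _ hm => ?_
  rw [Nat.choose_eq_zero_of_lt (by simpa using hm)]; simp

lemma eval_sinhDivPoly (n : ℕ) (z : ℂ) :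
    2 * z * (sinhDivPoly n).eval z = (1 + z / n) ^ n - (1 + -(z / n)) ^ n := by
  -- Both binomial sums are padded with zero terms to the even length `2 (n + 1)`, so that terms
  -- pair by parity: even powers cancel in the difference and odd ones double.
  rw [one_add_pow_eq_sum (z / n) (show n + 1 ≤ 2 * (n + 1) by omega),
    one_add_pow_eq_sum (-(z / n)) (show n + 1 ≤ 2 * (n + 1) by omega), sum_range_two_mul,
    sum_range_two_mul, ← Finset.sum_sub_distrib, sinhDivPoly, eval_finsetSum, Finset.mul_sum]
  refine Finset.sum_congr rfl fun j _ => ?_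
  have h1 : (-(z / n)) ^ (2 * j) = (z / n) ^ (2 * j) := by rw [pow_mul, neg_sq, ← pow_mul]
  have h2 : (-(z / n)) ^ (2 * j + 1) = -(z / n) ^ (2 * j + 1) := by
    rw [pow_succ, h1]; ring
  rw [h1, h2, div_pow z (n : ℂ) (2 * j + 1)]
  simp; ring

lemma eval_zero_sinhDivPoly {n : ℕ} (hn : n ≠ 0) : (sinhDivPoly n).eval 0 = 1 := by
  rw [sinhDivPoly, eval_finsetSum, Finset.sum_eq_single_of_mem 0 (by simp)]
  · simp [hn]
  · intro j _ hj; simp [hj]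

/-- A root satisfies `(1 + z / n) ^ n = (1 - z / n) ^ n`; taking moduli, `z` is equidistant from `n`
and `-n`, hence lies on the imaginary axis. -/
lemma re_eq_zero_of_eval_sinhDivPoly {n : ℕ} (hn : n ≠ 0) {z : ℂ}
    (hz : (sinhDivPoly n).eval z = 0) : z.re = 0 := by
  have h := eval_sinhDivPoly n z
  rw [hz, mul_zero, eq_comm, sub_eq_zero] at h
  have h1 := congrArg norm h
  rw [norm_pow, norm_pow, pow_left_inj₀ (norm_nonneg _) (norm_nonneg _) hn] at h1
  have h2 : ‖1 + z / n‖ ^ 2 = ‖1 + -(z / n)‖ ^ 2 := by rw [h1]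
  rw [← Complex.normSq_eq_norm_sq, ← Complex.normSq_eq_norm_sq, Complex.normSq_apply,
    Complex.normSq_apply] at h2
  simp only [Complex.add_re, Complex.neg_re, Complex.one_re, Complex.add_im, Complex.neg_im,
    Complex.one_im, Complex.div_natCast_re] at h2
  have h3 : z.re / n = 0 := by linarith
  simpa [hn] using h3

lemma tendsto_choose_div_pow (k : ℕ) :
    Tendsto (fun n : ℕ => (n.choose k : ℂ) / n ^ k) atTop (𝓝 ((k.factorial : ℂ)⁻¹)) := by
  have h : Tendsto (fun n : ℕ => (n.choose k : ℝ) / ((n : ℝ) ^ k / k.factorial)) atTop (𝓝 1) :=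
    (Asymptotics.isEquivalent_iff_tendsto_one (by
      filter_upwards [eventually_gt_atTop 0] with n hn; positivity)).1 (isEquivalent_choose k)
  have h2 := (h.mul_const ((k.factorial : ℝ)⁻¹))
  rw [one_mul] at h2
  have h3 := (Complex.continuous_ofReal.tendsto _).comp h2
  push_cast at h3
  refine h3.congr fun n => ?_
  have : (k.factorial : ℂ) ≠ 0 := by exact_mod_cast k.factorial_ne_zero
  simp only [Function.comp_apply]
  push_cast
  field_simp

lemma norm_choose_div_pow_le (n k : ℕ) :
    ‖(n.choose k : ℂ) / n ^ k‖ ≤ (k.factorial : ℝ)⁻¹ := by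
  rw [norm_div, norm_pow, Complex.norm_natCast, Complex.norm_natCast]
  refine div_le_of_le_mul₀ (by positivity) (by positivity) ?_
  have := Nat.choose_le_pow_div (α := ℝ) k n
  rwa [div_eq_inv_mul] at this

lemma tendsto_aeval_sinhDivPoly {A : Type*} [NormedRing A] [NormedAlgebra ℂ A] [CompleteSpace A]
    (T : A) : Tendsto (fun n => aeval T (sinhDivPoly n)) atTop (𝓝 (sinhDiv T)) := by
  have e : ∀ n, aeval T (sinhDivPoly n) =
      ∑' j : ℕ, ((n.choose (2 * j + 1) : ℂ) / n ^ (2 * j + 1)) • T ^ (2 * j) := by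
    intro n
    rw [tsum_eq_sum (s := Finset.range (n + 1))]
    · simp [sinhDivPoly, Algebra.smul_def]
    · intro j hj
      rw [Nat.choose_eq_zero_of_lt (by simp at hj; omega)]; simp
  simp only [e]
  -- Coefficients converge one by one. The dominating series uses `(2j)!` in place of `(2j + 1)!`,
  -- which makes it a subseries of the exponential series of `T`.
  refine tendsto_tsum_of_dominated_convergence
    (bound := fun j : ℕ => ‖(((2 * j).factorial : ℂ)⁻¹) • T ^ (2 * j)‖)
    ((NormedSpace.norm_expSeries_summable' (𝕂 := ℂ) T).comp_injective
      (i := fun n : ℕ => 2 * n) (fun a b h => by simpa using h)) (fun j => ?_)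
    (Eventually.of_forall fun n j => ?_)
  · exact (tendsto_choose_div_pow (2 * j + 1)).smul_const _
  · rw [norm_smul, norm_smul]
    gcongr
    refine (norm_choose_div_pow_le _ _).trans ?_
    rw [norm_inv, Complex.norm_natCast]
    gcongr
    omega

/-- If `T` generates a one-parameter group of isometries `exp (i s T)`, then `sinh T / T` is
expansive and invertible. -/
theorem isExpansiveUnit_sinhDiv {E : Type*} [NormedAddCommGroup E] [NormedSpace ℂ E]
    [CompleteSpace E] (T : E →L[ℂ] E)
    (hT : ∀ s : ℝ, ‖NormedSpace.exp (((s : ℂ) * Complex.I) • T)‖ ≤ 1) :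
    IsExpansiveUnit (sinhDiv T) := by
  refine IsExpansiveUnit.of_tendsto (tendsto_aeval_sinhDivPoly T) ?_
  filter_upwards [eventually_ne_atTop 0] with n hn
  exact isExpansiveUnit_aeval T hT _ _ rfl (eval_zero_sinhDivPoly hn)
    fun z => re_eq_zero_of_eval_sinhDivPoly hn

end SinhDiv

/-! ### The derivative of the exponential map -/

/-! ### Power series of intertwined operators -/

section ExpSeries

variable {E F : Type*} [NormedAddCommGroup E] [NormedSpace ℂ E]
  [NormedAddCommGroup F] [NormedSpace ℂ F]

lemma pow_intertwine {S : E →L[ℂ] E} {T : F →L[ℂ] F} {ι : E →L[ℂ] F}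
    (h : ∀ x, T (ι x) = ι (S x)) (n : ℕ) (x : E) : (T ^ n) (ι x) = ι ((S ^ n) x) := by
  induction n generalizing x with
  | zero => simp
  | succ n ih => rw [pow_succ, pow_succ, mul_apply_eq_comp, mul_apply_eq_comp, h, ih]

variable [CompleteSpace E] [CompleteSpace F]

/-- Intertwining passes to powers and then, by continuity, to sums of series. It is meant for `ι`
the inclusion of `M` in `L^p`, with `S` and `T` a multiple of `ad w` and of its extension. -/
lemma exp_intertwine {S : E →L[ℂ] E} {T : F →L[ℂ] F} {ι : E →L[ℂ] F}
    (h : ∀ x, T (ι x) = ι (S x)) (x : E) :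
    NormedSpace.exp T (ι x) = ι (NormedSpace.exp S x) := by
  have h1 := (NormedSpace.exp_series_hasSum_exp' (𝕂 := ℂ) T).mapL
    (ContinuousLinearMap.apply ℂ F (ι x))
  have h2 := (NormedSpace.exp_series_hasSum_exp' (𝕂 := ℂ) S).mapL
    (ι.comp (ContinuousLinearMap.apply ℂ E x))
  refine h1.unique (h2.congr_fun fun n => ?_)
  simp [pow_intertwine h]

lemma sinhDiv_intertwine {S : E →L[ℂ] E} {T : F →L[ℂ] F} {ι : E →L[ℂ] F}
    (h : ∀ x, T (ι x) = ι (S x)) (x : E) : sinhDiv T (ι x) = ι (sinhDiv S x) := by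
  have h1 := (hasSum_sinhDiv T).mapL (ContinuousLinearMap.apply ℂ F (ι x))
  have h2 := (hasSum_sinhDiv S).mapL (ι.comp (ContinuousLinearMap.apply ℂ E x))
  refine h1.unique (h2.congr_fun fun n => ?_)
  simp [pow_intertwine h]

end ExpSeries

/-! ### The exponential in a Banach algebra and its directional derivatives -/

section ExpAlgebra

variable {A : Type*} [NormedRing A] [NormedAlgebra ℂ A] [CompleteSpace A]

lemma continuous_normedSpace_exp : Continuous (NormedSpace.exp : A → A) :=
  continuous_iff_continuousAt.2 fun x => (NormedSpace.exp_analytic (𝕂 := ℂ) x).continuousAt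

lemma exp_add_of_commute_complex {x y : A} (h : Commute x y) :
    NormedSpace.exp (x + y) = NormedSpace.exp x * NormedSpace.exp y :=
  NormedSpace.exp_add_of_commute_of_mem_ball (𝕂 := ℂ) h
    ((NormedSpace.expSeries_radius_eq_top ℂ A).symm ▸ edist_lt_top _ _)
    ((NormedSpace.expSeries_radius_eq_top ℂ A).symm ▸ edist_lt_top _ _)

lemma exp_mul_exp_neg_complex (x : A) : NormedSpace.exp x * NormedSpace.exp (-x) = 1 := by
  rw [← exp_add_of_commute_complex (Commute.refl x).neg_right, add_neg_cancel,
    NormedSpace.exp_zero]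

lemma exp_neg_mul_exp_complex (x : A) : NormedSpace.exp (-x) * NormedSpace.exp x = 1 := by
  simpa using exp_mul_exp_neg_complex (-x)

lemma exp_mulLeft_apply (w y : A) :
    NormedSpace.exp (ContinuousLinearMap.mul ℂ A w) y = NormedSpace.exp w * y := by
  have hp : ∀ n : ℕ, (ContinuousLinearMap.mul ℂ A w ^ n) y = w ^ n * y := by
    intro n
    induction n with
    | zero => simp
    | succ n ih => rw [pow_succ', mul_apply_eq_comp, ih, pow_succ', mul_assoc]; rfl
  have h1 := (NormedSpace.exp_series_hasSum_exp' (𝕂 := ℂ) (ContinuousLinearMap.mul ℂ A w)).mapL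
    (ContinuousLinearMap.apply ℂ A y)
  have h2 := (NormedSpace.exp_series_hasSum_exp' (𝕂 := ℂ) w).mul_right y
  refine h1.unique (h2.congr_fun fun n => ?_)
  simp [hp]

lemma exp_mulRight_apply (w y : A) :
    NormedSpace.exp ((ContinuousLinearMap.mul ℂ A).flip w) y = y * NormedSpace.exp w := by
  have hp : ∀ n : ℕ, ((ContinuousLinearMap.mul ℂ A).flip w ^ n) y = y * w ^ n := by
    intro n
    induction n with
    | zero => simp
    | succ n ih => rw [pow_succ', mul_apply_eq_comp, ih, pow_succ, ← mul_assoc]; rfl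
  have h1 := (NormedSpace.exp_series_hasSum_exp' (𝕂 := ℂ)
    ((ContinuousLinearMap.mul ℂ A).flip w)).mapL (ContinuousLinearMap.apply ℂ A y)
  have h2 := (NormedSpace.exp_series_hasSum_exp' (𝕂 := ℂ) w).mul_left y
  refine h1.unique (h2.congr_fun fun n => ?_)
  simp [hp]

/-- The exponential series is integrated term by term over a symmetric interval: odd powers vanish,
and the integral of `s ^ (2n)` is `(1/2) ^ (2n) / (2n + 1)`, which turns `1 / (2n)!` into `1 / (2n +
1)!` and `T` into `T / 2`. -/
lemma integral_exp_smul (T : A) :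
    ∫ s in (-(1 / 2) : ℝ)..(1 / 2), NormedSpace.exp (s • T) = sinhDiv ((1 / 2 : ℝ) • T) := by
  have hint : ∀ n : ℕ, ∫ s in (-(1 / 2) : ℝ)..(1 / 2), s ^ n • ((n.factorial : ℂ)⁻¹ • T ^ n) =
      (((1 / 2 : ℝ) ^ (n + 1) - (-(1 / 2) : ℝ) ^ (n + 1)) / (n + 1)) •
        ((n.factorial : ℂ)⁻¹ • T ^ n) := fun n => by
    rw [intervalIntegral.integral_smul_const, integral_pow]
  let f : ℕ → C(ℝ, A) := fun n => ⟨fun s => s ^ n • ((n.factorial : ℂ)⁻¹ • T ^ n), by fun_prop⟩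
  have hsum := intervalIntegral.hasSum_intervalIntegral_of_summable_norm
    (a := (-(1 / 2) : ℝ)) (b := 1 / 2) (f := f) ?_
  · have he : ∀ s : ℝ, ∑' n, f n s = NormedSpace.exp (s • T) := fun s => by
      rw [NormedSpace.exp_eq_tsum ℂ]
      refine tsum_congr fun n => ?_
      simp only [f, ContinuousMap.coe_mk]
      rw [smul_pow, smul_comm]
    simp only [he] at hsum
    simp only [f, ContinuousMap.coe_mk, hint] at hsum
    have hinj : Function.Injective fun n : ℕ => 2 * n := fun a b h => by simpa using h
    have hodd : ∀ n ∉ Set.range (fun n : ℕ => 2 * n),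
        (((1 / 2 : ℝ) ^ (n + 1) - (-(1 / 2) : ℝ) ^ (n + 1)) / (n + 1)) •
          ((n.factorial : ℂ)⁻¹ • T ^ n) = 0 := by
      intro n hn
      have : Even (n + 1) := by
        rw [Nat.even_add_one]
        rintro ⟨k, hk⟩
        exact hn ⟨k, by simp only; omega⟩
      rw [this.neg_pow, sub_self, zero_div, zero_smul]
    rw [← hinj.hasSum_iff hodd] at hsum
    refine hsum.unique ((hasSum_sinhDiv ((1 / 2 : ℝ) • T)).congr_fun fun n => ?_)
    simp only [Function.comp_apply]
    have hod : Odd (2 * n + 1) := by simp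
    rw [hod.neg_pow, smul_pow, smul_comm, ← Complex.coe_smul, ← Complex.coe_smul, smul_smul,
      smul_smul, Nat.factorial_succ]
    congr 1
    have h1 : (2 * (n : ℂ) + 1) ≠ 0 := by exact_mod_cast (2 * n).succ_ne_zero
    have h2 : ((2 * n).factorial : ℂ) ≠ 0 := by exact_mod_cast (2 * n).factorial_ne_zero
    push_cast
    field_simp
    ring
  · refine Summable.of_nonneg_of_le (fun _ => norm_nonneg _) (fun n => ?_)
      (NormedSpace.norm_expSeries_summable' (𝕂 := ℂ) T)
    rw [ContinuousMap.norm_le _ (norm_nonneg _)]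
    rintro ⟨s, hs⟩
    have hs' : s ∈ uIcc (-(1 / 2) : ℝ) (1 / 2) := hs
    rw [uIcc_of_le (by norm_num)] at hs'
    simp only [f, ContinuousMap.restrict_apply, ContinuousMap.coe_mk]
    rw [norm_smul, norm_pow]
    refine mul_le_of_le_one_left (norm_nonneg _) (pow_le_one₀ (norm_nonneg _) ?_)
    rw [Real.norm_eq_abs, abs_le]
    constructor <;> linarith [hs'.1, hs'.2]

/-- Duhamel's formula. -/
lemma exp_sub_exp_eq_integral (a b : A) :
    NormedSpace.exp b - NormedSpace.exp a =
      ∫ s in (0 : ℝ)..1, NormedSpace.exp (s • b) * (b - a) * NormedSpace.exp ((1 - s) • a) := by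
  -- The path `exp (s b) exp ((1 - s) a)` runs from `exp a` to `exp b`, and the integrand is its
  -- derivative.
  have hd : ∀ s : ℝ, HasDerivAt (fun s : ℝ => NormedSpace.exp (s • b) *
      NormedSpace.exp ((1 - s) • a))
      (NormedSpace.exp (s • b) * (b - a) * NormedSpace.exp ((1 - s) • a)) s := fun s => by
    have h1 := hasDerivAt_exp_smul_const (𝕂 := ℝ) b s
    have h2 := (hasDerivAt_exp_smul_const' (𝕂 := ℝ) a (1 - s)).scomp s
      ((hasDerivAt_id s).const_sub 1)
    refine (h1.mul h2).congr_deriv ?_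
    simp only [Function.comp_apply]
    rw [neg_one_smul]; noncomm_ring
  rw [intervalIntegral.integral_eq_sub_of_hasDerivAt (fun s _ => hd s)
    (Continuous.intervalIntegrable ?_ _ _)]
  · simp [NormedSpace.exp_zero]
  · have := continuous_normedSpace_exp (A := A)
    fun_prop

/-- Duhamel's formula between `w` and `w + ε y` writes the difference quotient as an integral that
is continuous in `ε`, up to and including `ε = 0`. -/
lemma hasDerivAt_exp_add_smul (w y : A) :
    HasDerivAt (fun ε : ℝ => NormedSpace.exp (w + ε • y))
      (∫ s in (0 : ℝ)..1, NormedSpace.exp (s • w) * y * NormedSpace.exp ((1 - s) • w)) 0 := by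
  have hexp := continuous_normedSpace_exp (A := A)
  have hc : Continuous fun ε : ℝ => ∫ s in (0 : ℝ)..1,
      NormedSpace.exp (s • (w + ε • y)) * y * NormedSpace.exp ((1 - s) • w) :=
    intervalIntegral.continuous_parametric_intervalIntegral_of_continuous' (by fun_prop) 0 1
  rw [hasDerivAt_iff_tendsto_slope]
  have h0 := (hc.tendsto 0).mono_left (nhdsWithin_le_nhds (s := {0}ᶜ))
  simp only [zero_smul, add_zero] at h0
  refine h0.congr' ?_
  filter_upwards [self_mem_nhdsWithin] with ε hε
  rw [slope_def_module, sub_zero, zero_smul, add_zero, exp_sub_exp_eq_integral,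
    ← intervalIntegral.integral_smul]
  refine intervalIntegral.integral_congr fun s _ => ?_
  have hε' : ε ≠ 0 := hε
  simp only [add_sub_cancel_left]
  rw [mul_smul_comm, smul_mul_assoc, smul_smul, inv_mul_cancel₀ hε', one_smul]

end ExpAlgebra

/-! ### The differential of the exponential on a C*-algebra -/

section DExp

variable {M : Type*} [CStarAlgebra M]

/-- `ad w` is the difference of the commuting left and right multiplications by `w`, so its
exponential factors. -/
lemma exp_adOp_apply (w y : M) :
    NormedSpace.exp (adOp w) y = NormedSpace.exp w * y * NormedSpace.exp (-w) := by
  have hcomm : Commute (ContinuousLinearMap.mul ℂ M w)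
      (-(ContinuousLinearMap.mul ℂ M).flip w) := by
    refine Commute.neg_right ?_
    ext x
    simp [mul_assoc]
  rw [adOp, sub_eq_add_neg, exp_add_of_commute_complex hcomm, mul_apply_eq_comp,
    exp_mulLeft_apply, ← map_neg, exp_mulRight_apply, mul_assoc]

lemma smul_adOp (c : ℂ) (w : M) : c • adOp w = adOp (c • w) := by
  ext x; simp [adOp_apply, smul_sub]

lemma real_smul_adOp (c : ℝ) (w : M) : c • adOp w = adOp (c • w) := by
  ext x; simp [adOp_apply, smul_sub]

/-- The derivative of the exponential map at `w`. -/
noncomputable def dexp (w : M) : M →L[ℝ] M :=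
  (((ContinuousLinearMap.mul ℂ M (NormedSpace.exp ((1 / 2 : ℝ) • w))).comp
    ((ContinuousLinearMap.mul ℂ M).flip (NormedSpace.exp ((1 / 2 : ℝ) • w)))).comp
      (sinhDiv (adOp ((1 / 2 : ℝ) • w)))).restrictScalars ℝ

lemma dexp_apply (w y : M) :
    dexp w y = NormedSpace.exp ((1 / 2 : ℝ) • w) *
      (sinhDiv (adOp ((1 / 2 : ℝ) • w)) y * NormedSpace.exp ((1 / 2 : ℝ) • w)) := rfl

/-- Extracting `e^(w/2)` on both sides leaves `exp ((s - 1/2) ad w) y`; after the shift the interval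
is symmetric and `integral_exp_smul` applies. The symmetric splitting is chosen to match the factors
`a^(-1/2)` of the Finsler norm. -/
lemma integral_exp_mul_mul_exp (w y : M) :
    ∫ s in (0 : ℝ)..1, NormedSpace.exp (s • w) * y * NormedSpace.exp ((1 - s) • w) =
      dexp w y := by
  have hexp := continuous_normedSpace_exp (A := M)
  have hexp' := continuous_normedSpace_exp (A := M →L[ℂ] M)
  have h1 : ∀ s : ℝ, NormedSpace.exp (s • w) * y * NormedSpace.exp ((1 - s) • w) =
      (((ContinuousLinearMap.mul ℂ M (NormedSpace.exp ((1 / 2 : ℝ) • w))).comp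
        ((ContinuousLinearMap.mul ℂ M).flip (NormedSpace.exp ((1 / 2 : ℝ) • w)))).comp
          (ContinuousLinearMap.id ℂ M)) (ContinuousLinearMap.apply ℂ M y
            (NormedSpace.exp ((s - 1 / 2) • adOp w))) := fun s => by
    rw [real_smul_adOp, ContinuousLinearMap.apply_apply, exp_adOp_apply]
    have e1 : NormedSpace.exp (s • w) =
        NormedSpace.exp ((1 / 2 : ℝ) • w) * NormedSpace.exp ((s - 1 / 2) • w) := by
      rw [← exp_add_of_commute_complex
        (((Commute.refl w).smul_left _).smul_right _), ← add_smul]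
      congr 2; ring
    have e2 : NormedSpace.exp ((1 - s) • w) =
        NormedSpace.exp (-((s - 1 / 2) • w)) * NormedSpace.exp ((1 / 2 : ℝ) • w) := by
      rw [← neg_smul, ← exp_add_of_commute_complex
        (((Commute.refl w).smul_left _).smul_right _), ← add_smul]
      congr 2; ring
    rw [e1, e2]
    simp [mul_assoc]
  simp only [h1]
  rw [ContinuousLinearMap.intervalIntegral_comp_comm _
      (Continuous.intervalIntegrable (by fun_prop) _ _),
    ContinuousLinearMap.intervalIntegral_comp_comm _
      (Continuous.intervalIntegrable (by fun_prop) _ _),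
    intervalIntegral.integral_comp_sub_right (fun s : ℝ => NormedSpace.exp (s • adOp w))]
  have hI : ∫ s in (0 - 1 / 2 : ℝ)..(1 - 1 / 2), NormedSpace.exp (s • adOp w) =
      sinhDiv (adOp ((1 / 2 : ℝ) • w)) := by
    rw [← real_smul_adOp, show (0 - 1 / 2 : ℝ) = -(1 / 2) by norm_num,
      show (1 - 1 / 2 : ℝ) = 1 / 2 by norm_num]
    exact integral_exp_smul (adOp w)
  rw [hI]
  rfl

lemma contDiff_normedSpace_exp : ContDiff ℝ 1 (NormedSpace.exp : M → M) :=
  contDiff_iff_contDiffAt.2 fun x => (NormedSpace.exp_analytic (𝕂 := ℝ) x).contDiffAt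

/-- Differentiability comes from analyticity, so only the directional derivatives have to be
identified. -/
lemma hasFDerivAt_normedSpace_exp (w : M) :
    HasFDerivAt (NormedSpace.exp : M → M) (dexp w) w := by
  have h := (contDiff_normedSpace_exp (M := M)).differentiable one_ne_zero w |>.hasFDerivAt
  suffices hD : fderiv ℝ (NormedSpace.exp : M → M) w = dexp w by rwa [hD] at h
  ext y
  have h1 : HasDerivAt (fun ε : ℝ => w + ε • y) y 0 := by
    simpa using ((hasDerivAt_id (0 : ℝ)).smul_const y).const_add w
  have h2 : HasFDerivAt (NormedSpace.exp : M → M) (fderiv ℝ NormedSpace.exp w)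
      (w + (0 : ℝ) • y) := by simpa using h
  rw [← integral_exp_mul_mul_exp]
  exact (h2.comp_hasDerivAt (0 : ℝ) h1).unique (hasDerivAt_exp_add_smul w y)

lemma exp_mem_unitary_of_isSelfAdjoint {w : M} (hw : IsSelfAdjoint w) (s : ℝ) :
    NormedSpace.exp (((s : ℂ) * Complex.I) • w) ∈ unitary M := by
  have hs : star (((s : ℂ) * Complex.I) • w) = -(((s : ℂ) * Complex.I) • w) := by
    simp [star_smul, hw.star_eq]
  rw [Unitary.mem_iff, NormedSpace.star_exp, hs]
  exact ⟨exp_neg_mul_exp_complex _, exp_mul_exp_neg_complex _⟩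

/-- Unitary conjugation is isometric for the uniform norm. This case on `M` itself is what makes
`dexp w` invertible there, whatever `p` is. -/
lemma isExpansiveUnit_sinhDiv_adOp {w : M} (hw : IsSelfAdjoint w) :
    IsExpansiveUnit (sinhDiv (adOp w)) := by
  refine isExpansiveUnit_sinhDiv _ fun s => ?_
  have hu := exp_mem_unitary_of_isSelfAdjoint hw s
  have hu' : NormedSpace.exp (-(((s : ℂ) * Complex.I) • w)) ∈ unitary M := by
    have := exp_mem_unitary_of_isSelfAdjoint hw (-s)
    rwa [Complex.ofReal_neg, neg_mul, neg_smul] at this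
  refine ContinuousLinearMap.opNorm_le_bound _ zero_le_one fun y => ?_
  rw [smul_adOp, exp_adOp_apply, CStarRing.norm_mul_mem_unitary _ hu',
    CStarRing.norm_mem_unitary_mul _ hu, one_mul]

lemma isUnit_dexp {w : M} (hw : IsSelfAdjoint w) : IsUnit (dexp w) := by
  obtain ⟨u, hu⟩ := (isExpansiveUnit_sinhDiv_adOp (IsSelfAdjoint.smul (.all (1 / 2 : ℝ)) hw)).1
  set e := NormedSpace.exp ((1 / 2 : ℝ) • w) with he
  set e' := NormedSpace.exp (-((1 / 2 : ℝ) • w)) with he'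
  have h1 : e * e' = 1 := exp_mul_exp_neg_complex _
  have h2 : e' * e = 1 := exp_neg_mul_exp_complex _
  have hu1 : ∀ y, (u : M →L[ℂ] M) ((↑u⁻¹ : M →L[ℂ] M) y) = y := fun y => by
    rw [← mul_apply_eq_comp, Units.mul_inv, one_apply_eq_self]
  have hu2 : ∀ y, (↑u⁻¹ : M →L[ℂ] M) ((u : M →L[ℂ] M) y) = y := fun y => by
    rw [← mul_apply_eq_comp, Units.inv_mul, one_apply_eq_self]
  let V : M →L[ℝ] M := ((↑u⁻¹ : M →L[ℂ] M).comp ((ContinuousLinearMap.mul ℂ M e').comp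
    ((ContinuousLinearMap.mul ℂ M).flip e'))).restrictScalars ℝ
  have hV : ∀ y, V y = (↑u⁻¹ : M →L[ℂ] M) (e' * (y * e')) := fun y => rfl
  refine ⟨⟨dexp w, V, ?_, ?_⟩, rfl⟩
  · ext y
    rw [mul_apply_eq_comp, dexp_apply, hV, ← hu, hu1, ← he, one_apply_eq_self, mul_assoc,
      mul_assoc, h2, ← mul_assoc, h1, one_mul, mul_one]
  · ext y
    rw [mul_apply_eq_comp, hV, dexp_apply, ← he, mul_assoc, mul_assoc, h1, mul_one, ← mul_assoc,
      h2, one_mul, ← hu, hu2, one_apply_eq_self]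

end DExp

/-! ### The operator `F(ad w)` on `L^p` -/

section PNorm

variable {M : Type*} [CStarAlgebra M] [PartialOrder M] [StarOrderedRing M]
  (τ : FaithfulNormalTracialState M) (p : ℝ≥0∞)

namespace FaithfulNormalTracialState

lemma pNorm_unitary_mul {u : M} (hu : u ∈ unitary M) (x : M) :
    τ.pNorm p (u * x) = τ.pNorm p x := by
  have h : CFC.abs (u * x) = CFC.abs x := by
    rw [CFC.abs, CFC.abs, star_mul, mul_assoc, ← mul_assoc (star u),
      Unitary.star_mul_self_of_mem hu, one_mul]
  rw [pNorm, pNorm, h, CStarRing.norm_mem_unitary_mul _ hu]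

/-- For finite `p` this is traciality: `f(x* x)` and `f(x x*)` have the same trace. -/
lemma pNorm_star (x : M) : τ.pNorm p (star x) = τ.pNorm p x := by
  by_cases hp : p = ∞
  · simp [pNorm, hp]
  · rw [pNorm_of_ne_top τ hp, pNorm_of_ne_top τ hp, trAbsPow_eq τ ENNReal.toReal_nonneg,
      trAbsPow_eq τ ENNReal.toReal_nonneg, star_star, ← reTr_cfc_swap τ _ _ x]
    exact Continuous.rpow_const (by fun_prop) fun t => Or.inr (by positivity)

lemma pNorm_mul_unitary {u : M} (hu : u ∈ unitary M) (x : M) :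
    τ.pNorm p (x * u) = τ.pNorm p x := by
  rw [← pNorm_star, star_mul, pNorm_unitary_mul τ p (Unitary.star_mem hu), pNorm_star]

variable [Fact (1 ≤ p)]

/-- A self-adjoint contraction `b` is the average of the unitary `b + i √(1 - b²)` and its adjoint,
and multiplication by a unitary preserves `‖·‖_p`; the triangle inequality then replaces Hölder's
inequality. -/
lemma pNorm_mul_le {w : M} (hw : IsSelfAdjoint w) (x : M) :
    τ.pNorm p (w * x) ≤ ‖w‖ * τ.pNorm p x := by
  rcases eq_or_ne w 0 with rfl | hw0
  · simp [show τ.pNorm p (0 : M) = 0 from norm_zero (E := WithPNorm τ p)]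
  have hn : 0 < ‖w‖ := norm_pos_iff.2 hw0
  obtain ⟨b, hb⟩ : ∃ b : M, b = (‖w‖⁻¹ : ℝ) • w := ⟨_, rfl⟩
  have hbs : IsSelfAdjoint b := hb ▸ IsSelfAdjoint.smul (.all _) hw
  have hb1 : ‖b‖ ≤ 1 := by
    rw [hb, norm_smul, norm_inv, norm_norm, inv_mul_cancel₀ hn.ne']
  have hu := hbs.self_add_I_smul_cfcSqrt_sub_sq_mem_unitary b hb1
  have e : b = (1 / 2 : ℂ) • ((b + Complex.I • CFC.sqrt (1 - b ^ 2)) +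
      star (b + Complex.I • CFC.sqrt (1 - b ^ 2))) := by
    have hs : star (CFC.sqrt (1 - b ^ 2)) = CFC.sqrt (1 - b ^ 2) :=
      (IsSelfAdjoint.of_nonneg (CFC.sqrt_nonneg _)).star_eq
    rw [star_add, star_smul, hs, hbs.star_eq]
    simp only [Complex.star_def, Complex.conj_I]
    module
  set u := b + Complex.I • CFC.sqrt (1 - b ^ 2)
  have e2 : w * x = ((‖w‖ * (1 / 2) : ℝ) : ℂ) • (u * x + star u * x) := by
    have : w = (‖w‖ : ℂ) • b := by
      rw [hb, Complex.coe_smul, smul_smul, mul_inv_cancel₀ hn.ne', one_smul]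
    conv_lhs => rw [this, e]
    rw [smul_smul, smul_mul_assoc, add_mul]
    push_cast
    rfl
  have h := τ.pNorm_add_le (p := p) Fact.out (u * x) (star u * x)
  rw [pNorm_unitary_mul τ p hu, pNorm_unitary_mul τ p (Unitary.star_mem hu)] at h
  rw [e2, pNorm_smul τ Fact.out, Complex.norm_of_nonneg (by positivity)]
  calc ‖w‖ * (1 / 2) * τ.pNorm p (u * x + star u * x)
      ≤ ‖w‖ * (1 / 2) * (τ.pNorm p x + τ.pNorm p x) := by gcongr
    _ = ‖w‖ * τ.pNorm p x := by ring

lemma pNorm_mul_le' {w : M} (hw : IsSelfAdjoint w) (x : M) :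
    τ.pNorm p (x * w) ≤ ‖w‖ * τ.pNorm p x := by
  rw [← pNorm_star, star_mul, hw.star_eq, ← pNorm_star τ p x]
  exact pNorm_mul_le τ p hw _

open scoped ComplexStarModule in
-- The factor 2 comes from splitting `x` into real and imaginary parts, each handled by
-- `pNorm_mul_le`. The constant is immaterial: only continuity of the inclusion in `L^p` is wanted.
lemma pNorm_le_mul_norm (x : M) : τ.pNorm p x ≤ 2 * τ.pNorm p 1 * ‖x‖ := by
  have h1 := pNorm_mul_le τ p (realPart x).2 1
  have h2 := pNorm_mul_le τ p (imaginaryPart x).2 1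
  have h3 := τ.pNorm_add_le (p := p) Fact.out (realPart x : M) (Complex.I • (imaginaryPart x : M))
  rw [pNorm_smul τ Fact.out, Complex.norm_I, one_mul, realPart_add_I_smul_imaginaryPart] at h3
  have h4 : ‖(realPart x : M)‖ ≤ ‖x‖ := realPart.norm_le x
  have h5 : ‖(imaginaryPart x : M)‖ ≤ ‖x‖ := imaginaryPart.norm_le x
  have h6 := τ.pNorm_nonneg p 1
  rw [mul_one] at h1 h2
  nlinarith

end FaithfulNormalTracialState

variable [Fact (1 ≤ p)]

/-- The inclusion of `M` in `L^p(M, τ)` as a continuous linear map. -/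
noncomputable def toTraceLpCLM : M →L[ℂ] TraceLp τ p :=
  LinearMap.mkContinuous
    { toFun := toTraceLp τ p
      map_add' := fun x y =>
        UniformSpace.Completion.coe_add (toWithPNorm τ p x) (toWithPNorm τ p y)
      map_smul' := fun c x => UniformSpace.Completion.coe_smul c (toWithPNorm τ p x) }
    (2 * τ.pNorm p 1) fun x => (norm_toTraceLp τ p x).trans_le (τ.pNorm_le_mul_norm p x)

lemma toTraceLpCLM_apply (x : M) : toTraceLpCLM τ p x = toTraceLp τ p x := rfl

lemma denseRange_toTraceLp : DenseRange (toTraceLp τ p) :=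
  UniformSpace.Completion.denseRange_coe (α := WithPNorm τ p)

lemma exists_adOp_extension {w : M} (hw : IsSelfAdjoint w) :
    ∃ T : TraceLp τ p →L[ℂ] TraceLp τ p,
      ∀ x : M, T (toTraceLp τ p x) = toTraceLp τ p (adOp w x) := by
  have hb : ∀ x : M, τ.pNorm p (adOp w x) ≤ 2 * ‖w‖ * τ.pNorm p x := fun x => by
    have h := τ.pNorm_add_le (p := p) Fact.out (w * x) ((-1 : ℂ) • (x * w))
    rw [τ.pNorm_smul Fact.out, norm_neg, norm_one, one_mul] at h
    have e : adOp w x = w * x + (-1 : ℂ) • (x * w) := by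
      rw [adOp_apply, neg_one_smul, sub_eq_add_neg]
    rw [e]
    linarith [τ.pNorm_mul_le p hw x, τ.pNorm_mul_le' p hw x]
  let S : WithPNorm τ p →L[ℂ] WithPNorm τ p := LinearMap.mkContinuous
    { toFun := fun x => toWithPNorm τ p (adOp w (x : M))
      map_add' := fun x y => map_add (adOp w) (x : M) (y : M)
      map_smul' := fun c x => map_smul (adOp w) c (x : M) } (2 * ‖w‖) hb
  exact ⟨S.completion, fun x =>
    UniformSpace.Completion.map_coe S.uniformContinuous (toWithPNorm τ p x)⟩

/-- On the dense image of `M`, `exp (i s T)` is conjugation by the unitary `exp (i s w)`, which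
preserves `‖·‖_p`; by density it is a contraction of `L^p`. -/
lemma isExpansiveUnit_sinhDiv_extension {w : M} (hw : IsSelfAdjoint w)
    {T : TraceLp τ p →L[ℂ] TraceLp τ p}
    (hT : ∀ x : M, T (toTraceLp τ p x) = toTraceLp τ p (adOp w x)) :
    IsExpansiveUnit (sinhDiv T) := by
  refine isExpansiveUnit_sinhDiv _ fun s => ?_
  have hu := exp_mem_unitary_of_isSelfAdjoint hw s
  have hu' : NormedSpace.exp (-(((s : ℂ) * Complex.I) • w)) ∈ unitary M := by
    have := exp_mem_unitary_of_isSelfAdjoint hw (-s)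
    rwa [Complex.ofReal_neg, neg_mul, neg_smul] at this
  refine ContinuousLinearMap.opNorm_le_bound _ zero_le_one fun z => ?_
  refine (denseRange_toTraceLp τ p).induction_on z
    (isClosed_le (by fun_prop) (by fun_prop)) fun x => ?_
  have h : ∀ x, (((s : ℂ) * Complex.I) • T) (toTraceLpCLM τ p x) =
      toTraceLpCLM τ p (adOp (((s : ℂ) * Complex.I) • w) x) := fun x => by
    rw [← smul_adOp, smul_apply, smul_apply, map_smul,
      toTraceLpCLM_apply, toTraceLpCLM_apply, hT]
  rw [← toTraceLpCLM_apply, exp_intertwine h, exp_adOp_apply, toTraceLpCLM_apply,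
    toTraceLpCLM_apply, norm_toTraceLp, norm_toTraceLp, τ.pNorm_mul_unitary p hu',
    τ.pNorm_unitary_mul p hu, one_mul]

lemma sinhDiv_extension_apply {w : M} {T : TraceLp τ p →L[ℂ] TraceLp τ p}
    (hT : ∀ x : M, T (toTraceLp τ p x) = toTraceLp τ p (adOp w x)) (x : M) :
    sinhDiv T (toTraceLp τ p x) = toTraceLp τ p (sinhDiv (adOp w) x) :=
  sinhDiv_intertwine (ι := toTraceLpCLM τ p) hT x

lemma pNorm_le_pNorm_sinhDiv {w : M} (hw : IsSelfAdjoint w) (x : M) :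
    τ.pNorm p x ≤ τ.pNorm p (sinhDiv (adOp w) x) := by
  obtain ⟨T, hT⟩ := exists_adOp_extension τ p hw
  have := (isExpansiveUnit_sinhDiv_extension τ p hw hT).2 (toTraceLp τ p x)
  rwa [sinhDiv_extension_apply τ p hT, norm_toTraceLp, norm_toTraceLp] at this

end PNorm

/-! ### Lengths of curves -/

section Curves

variable {M : Type*} [CStarAlgebra M]

/-- By `isUnit_dexp` the inverse function theorem applies to `exp` at `Γ t`. Continuity keeps `Γ` in
the domain of the local inverse near `t`, so there `Γ` is the local inverse composed with `γ`. -/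
lemma contDiffWithinAt_of_exp {γ Γ : ℝ → M} {s : Set ℝ} {t : ℝ} (ht : t ∈ s)
    (hsa : IsSelfAdjoint (Γ t)) (he : ∀ r ∈ s, γ r = NormedSpace.exp (Γ r))
    (hc : ContinuousWithinAt Γ s t) (hγ : ContDiffWithinAt ℝ 1 γ s t) :
    ContDiffWithinAt ℝ 1 Γ s t := by
  obtain ⟨u, hu⟩ := isUnit_dexp hsa
  let e := ContinuousLinearEquiv.ofUnit u
  have hee : ((e : M ≃L[ℝ] M) : M →L[ℝ] M) = dexp (Γ t) := by rw [← hu]; rfl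
  have hd : HasFDerivAt (NormedSpace.exp : M → M) (e : M →L[ℝ] M) (Γ t) := by
    rw [hee]; exact hasFDerivAt_normedSpace_exp _
  have hcd := (contDiff_normedSpace_exp (M := M)).contDiffAt (x := Γ t)
  have hinv := (hcd.hasStrictFDerivAt' hd one_ne_zero).eventually_left_inverse
  have hg := hcd.to_localInverse hd one_ne_zero
  rw [← he t ht] at hg
  refine (hg.comp_contDiffWithinAt t hγ).congr_of_eventuallyEq ?_ ?_
  · filter_upwards [hc.eventually hinv, self_mem_nhdsWithin] with r hr hrs
    simp only [Function.comp_apply]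
    rw [he r hrs]
    exact hr.symm
  · simp only [Function.comp_apply]
    rw [he t ht]
    exact (hcd.localInverse_apply_image hd one_ne_zero).symm

lemma hasDerivWithinAt_of_exp {γ Γ : ℝ → M} {s : Set ℝ} {t : ℝ} (ht : t ∈ s)
    (he : ∀ r ∈ s, γ r = NormedSpace.exp (Γ r)) {y : M} (hΓ : HasDerivWithinAt Γ y s t) :
    HasDerivWithinAt γ (dexp (Γ t) y) s t :=
  ((hasFDerivAt_normedSpace_exp (Γ t)).comp_hasDerivWithinAt t hΓ).congr he (he t ht)

variable [PartialOrder M] [StarOrderedRing M]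

lemma isStrictlyPositive_exp {w : M} (hw : IsSelfAdjoint w) :
    IsStrictlyPositive (NormedSpace.exp w) :=
  IsStrictlyPositive.iff_of_unital.2 ⟨hw.exp_nonneg,
    ⟨⟨_, _, exp_mul_exp_neg_complex w, exp_neg_mul_exp_complex w⟩, rfl⟩⟩

lemma exp_rpow {w : M} (hw : IsSelfAdjoint w) (r : ℝ) :
    NormedSpace.exp w ^ r = NormedSpace.exp (r • w) := by
  rw [CFC.rpow_eq_cfc_real hw.exp_nonneg,
    ← CFC.real_exp_eq_normedSpace_exp hw,
    ← CFC.real_exp_eq_normedSpace_exp (IsSelfAdjoint.smul (.all r) hw),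
    ← cfc_comp' (fun x : ℝ => x ^ r) Real.exp w ?_ (by fun_prop),
    ← cfc_comp_const_mul r Real.exp w (by fun_prop)]
  · refine cfc_congr fun x _ => ?_
    rw [← Real.exp_mul, mul_comm]
  · rintro _ ⟨x, _, rfl⟩
    exact (Real.continuousAt_rpow_const _ _ (Or.inl (Real.exp_pos x).ne')).continuousWithinAt

lemma isPiecewiseSmooth_of_exp {γ Γ : ℝ → M} (hγ : IsPiecewiseSmooth γ)
    (h : ∀ t ∈ Icc (0 : ℝ) 1, IsSelfAdjoint (Γ t) ∧ γ t = NormedSpace.exp (Γ t)) :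
    IsPiecewiseSmooth Γ := by
  obtain ⟨hcont, n, t, h0, h1, hpc⟩ := hγ
  -- Self-adjointness forces `Γ = log γ`, and the logarithm is continuous on positive invertible
  -- elements.
  have hΓ : ContinuousOn Γ (Icc 0 1) := by
    refine (CFC.continuousOn_log.comp hcont fun s hs => ?_).congr fun s hs => ?_
    · rw [(h s hs).2]
      have := isStrictlyPositive_exp (h s hs).1
      exact ⟨.of_nonneg this.nonneg, this.isUnit⟩
    · simp only [Function.comp_apply]
      rw [(h s hs).2, CFC.log_exp _ (h s hs).1]
  have hmono : ∀ i j, i ≤ j → j ≤ n → t i ≤ t j := fun i j hij => by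
    induction j, hij using Nat.le_induction with
    | base => exact fun _ => le_rfl
    | succ j _ ih => exact fun hj => (ih (by omega)).trans (hpc j (by omega)).1.le
  refine ⟨hΓ, n, t, h0, h1, fun i hi => ?_⟩
  obtain ⟨hlt, hC1, hne⟩ := hpc i hi
  have hsub : Icc (t i) (t (i + 1)) ⊆ Icc 0 1 :=
    Icc_subset_Icc (h0 ▸ hmono 0 i (by omega) (by omega)) (h1 ▸ hmono (i + 1) n hi le_rfl)
  have hC : ContDiffOn ℝ 1 Γ (Icc (t i) (t (i + 1))) := fun s hs =>
    contDiffWithinAt_of_exp hs (h s (hsub hs)).1 (fun r hr => (h r (hsub hr)).2)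
      ((hΓ.mono hsub) s hs) (hC1 s hs)
  -- By the chain rule, a zero of the derivative of `Γ` would be a zero of that of `γ`; the
  -- subdivision of `γ` therefore serves for `Γ`.
  refine ⟨hlt, hC, fun s hs h0 => hne s hs ?_⟩
  have hd := ((hC.differentiableOn one_ne_zero) s hs).hasDerivWithinAt
  rw [h0] at hd
  have := hasDerivWithinAt_of_exp hs (fun r hr => (h r (hsub hr)).2) hd
  rw [map_zero] at this
  exact this.derivWithin (uniqueDiffOn_Icc hlt s hs)

variable (τ : FaithfulNormalTracialState M) (p : ℝ≥0∞)

/-- At the point `e^w` the factors `a^(-1/2)` are `e^(-w/2)`, which cancel the outer factors of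
`dexp w y`. -/
lemma finslerNorm_dexp {w : M} (hw : IsSelfAdjoint w) (y : M) :
    finslerNorm τ p (NormedSpace.exp w) (dexp w y) =
      τ.pNorm p (sinhDiv (adOp ((1 / 2 : ℝ) • w)) y) := by
  rw [finslerNorm, exp_rpow hw, dexp_apply, neg_smul]
  congr 1
  rw [← mul_assoc, exp_neg_mul_exp_complex, one_mul, mul_assoc, exp_mul_exp_neg_complex, mul_one]

variable [Fact (1 ≤ p)]

/-- The exponential metric increasing property for curves. -/
lemma linearLength_le_finslerLength {γ Γ : ℝ → M}
    (h : ∀ t ∈ Icc (0 : ℝ) 1, IsSelfAdjoint (Γ t) ∧ γ t = NormedSpace.exp (Γ t)) :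
    linearLength τ p Γ ≤ finslerLength τ p γ := by
  refine setLIntegral_mono' measurableSet_Icc fun t ht => ENNReal.ofReal_le_ofReal ?_
  by_cases hd : DifferentiableWithinAt ℝ Γ (Icc 0 1) t
  · have hγ := (hasDerivWithinAt_of_exp ht (fun r hr => (h r hr).2)
      hd.hasDerivWithinAt).derivWithin (uniqueDiffOn_Icc zero_lt_one t ht)
    rw [hγ, (h t ht).2, finslerNorm_dexp τ p (h t ht).1]
    exact pNorm_le_pNorm_sinhDiv τ p (IsSelfAdjoint.smul (.all (1 / 2 : ℝ)) (h t ht).1) _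
  -- At a corner of `Γ` the derivative takes the default value 0, so the left side vanishes.
  · rw [derivWithin_zero_of_not_differentiableWithinAt hd,
      show τ.pNorm p (0 : M) = 0 from norm_zero (E := WithPNorm τ p)]
    exact τ.pNorm_nonneg p _

/-- On each piece the increment is the integral of the derivative, and the increments add up by the
triangle inequality. The curve is pushed into `L^p`, where `‖·‖_p` is the norm of a Banach space. -/
lemma pNorm_sub_le_linearLength {Γ : ℝ → M} (hΓ : IsPiecewiseSmooth Γ) :
    ENNReal.ofReal (τ.pNorm p (Γ 1 - Γ 0)) ≤ linearLength τ p Γ := by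
  obtain ⟨-, n, t, h0, h1, hpc⟩ := hΓ
  have hmono : ∀ i j, i ≤ j → j ≤ n → t i ≤ t j := fun i j hij => by
    induction j, hij using Nat.le_induction with
    | base => exact fun _ => le_rfl
    | succ j _ ih => exact fun hj => (ih (by omega)).trans (hpc j (by omega)).1.le
  let ι : M →L[ℝ] TraceLp τ p := (toTraceLpCLM τ p).restrictScalars ℝ
  have hι : ∀ x, ENNReal.ofReal (τ.pNorm p x) = ‖ι x‖ₑ := fun x => by
    rw [← ofReal_norm]
    exact congrArg _ (norm_toTraceLp τ p x).symm
  have hpiece : ∀ i < n, ‖ι (Γ (t (i + 1))) - ι (Γ (t i))‖ₑ ≤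
      ∫⁻ s in Icc (t i) (t (i + 1)), ‖ι (derivWithin Γ (Icc 0 1) s)‖ₑ := fun i hi => by
    obtain ⟨hlt, hC1, -⟩ := hpc i hi
    have hsub : Icc (t i) (t (i + 1)) ⊆ Icc 0 1 :=
      Icc_subset_Icc (h0 ▸ hmono 0 i (by omega) (by omega)) (h1 ▸ hmono (i + 1) n hi le_rfl)
    refine (enorm_sub_le_lintegral_deriv_of_contDiffOn_Icc (f := fun s => ι (Γ s))
      (ι.contDiff.comp_contDiffOn hC1) hlt.le).trans_eq (lintegral_congr_ae ?_)
    -- Discarding the end points, a null set, leaves points where the derivative within `[0, 1]` is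
    -- the ordinary one.
    rw [← restrict_Ioo_eq_restrict_Icc]
    filter_upwards [self_mem_ae_restrict measurableSet_Ioo] with s hs
    have hn : Icc (t i) (t (i + 1)) ∈ 𝓝 s := Icc_mem_nhds hs.1 hs.2
    have hd : DifferentiableAt ℝ Γ s :=
      ((hC1.differentiableOn one_ne_zero) s (Ioo_subset_Icc_self hs)).differentiableAt hn
    rw [derivWithin_of_mem_nhds (mem_of_superset hn hsub)]
    exact congrArg _ (ι.hasFDerivAt.comp_hasDerivAt s hd.hasDerivAt).deriv
  -- Half-open intervals make consecutive pieces disjoint, so that the integrals add.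
  have key : ∀ k ≤ n, ‖ι (Γ (t k)) - ι (Γ (t 0))‖ₑ ≤
      ∫⁻ s in Ioc (t 0) (t k), ‖ι (derivWithin Γ (Icc 0 1) s)‖ₑ := by
    intro k
    induction k with
    | zero => simp
    | succ k ih =>
      intro hk
      have hp := hpiece k hk
      rw [← restrict_Ioc_eq_restrict_Icc] at hp
      rw [← Ioc_union_Ioc_eq_Ioc (hmono 0 k (by omega) (by omega)) (hpc k hk).1.le,
        lintegral_union measurableSet_Ioc (Ioc_disjoint_Ioc_of_le le_rfl),
        ← sub_add_sub_cancel' (ι (Γ (t k)))]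
      exact (enorm_add_le _ _).trans (add_le_add (ih (by omega)) hp)
  have hk := key n le_rfl
  rw [h0, h1, restrict_Ioc_eq_restrict_Icc, ← map_sub, ← hι] at hk
  simpa only [linearLength, hι] using hk

end Curves

/-! ### The exponential metric increasing property -/

theorem mainTheorem2 {M : Type*} [CStarAlgebra M] [WStarAlgebra M] [PartialOrder M]
    [StarOrderedRing M] (τ : FaithfulNormalTracialState M) (p : ℝ≥0∞) [Fact (1 ≤ p)] :
    (∀ w : M, IsSelfAdjoint w →
      ∃ T : TraceLp τ p →L[ℂ] TraceLp τ p,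
        (∀ x : M, T (toTraceLp τ p x) = toTraceLp τ p (adOp w x)) ∧
        (∀ x : M, sinhDiv T (toTraceLp τ p x) = toTraceLp τ p (sinhDiv (adOp w) x)) ∧
        IsUnit (sinhDiv T) ∧
        ∀ z : TraceLp τ p, ‖z‖ ≤ ‖sinhDiv T z‖) ∧
    (∀ γ Γ : ℝ → M, IsPiecewiseSmooth γ →
      (∀ t ∈ Icc (0 : ℝ) 1, IsSelfAdjoint (Γ t) ∧ γ t = NormedSpace.exp (Γ t)) →
      IsPiecewiseSmooth Γ ∧ linearLength τ p Γ ≤ finslerLength τ p γ) ∧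
    (∀ v w : M, IsSelfAdjoint v → IsSelfAdjoint w →
      ENNReal.ofReal (τ.pNorm p (w - v)) ≤
        geodesicDist τ p (NormedSpace.exp w) (NormedSpace.exp v)) := by
  have part2 : ∀ γ Γ : ℝ → M, IsPiecewiseSmooth γ →
      (∀ t ∈ Icc (0 : ℝ) 1, IsSelfAdjoint (Γ t) ∧ γ t = NormedSpace.exp (Γ t)) →
      IsPiecewiseSmooth Γ ∧ linearLength τ p Γ ≤ finslerLength τ p γ := fun γ Γ hγ h =>
    ⟨isPiecewiseSmooth_of_exp hγ h, linearLength_le_finslerLength τ p h⟩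
  refine ⟨fun w hw => ?_, part2, fun v w hv hw => ?_⟩
  · obtain ⟨T, hT⟩ := exists_adOp_extension τ p hw
    have hF := isExpansiveUnit_sinhDiv_extension τ p hw hT
    exact ⟨T, hT, sinhDiv_extension_apply τ p hT, hF.1, hF.2⟩
  · refine le_iInf fun γ => le_iInf fun hγ => le_iInf fun hpos => le_iInf fun h0 =>
      le_iInf fun h1 => ?_
    -- Each curve competing in the infimum is lifted by the logarithm to a self-adjoint curve from
    -- `w` to `v`.
    obtain ⟨hΓ, hle⟩ := part2 γ (fun t => CFC.log (γ t)) hγ fun t ht =>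
      ⟨.log, (CFC.exp_log _ (hpos t ht)).symm⟩
    have h := pNorm_sub_le_linearLength τ p hΓ
    simp only [h0, h1] at h
    rw [CFC.log_exp _ hv, CFC.log_exp _ hw, ← neg_sub,
      ← neg_one_smul ℂ, τ.pNorm_smul Fact.out, norm_neg, norm_one, one_mul] at h
    exact h.trans hle
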